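/- Let $\mathbb K=\mathbb R$ or $\mathbb C$, let $k\ge 2$, and let $\varphi_k:(\mathbb K^{2k-2},0)\to(\mathbb K^{2k-1},0)$ be the minimal cross cap mapping of multiplicity $k$, \[ \varphi_k(u_1,\dots,u_{k-2},v_1,\dots,v_{k-1},y)=\Bigl(u_1,\dots,u_{k-2},v_1,\dots,v_{k-1},\;y^k+\sum_{i=1}^{k-2}u_iy^i,\;\sum_{i=1}^{k-1}v_iy^i\Bigr), \] with target coordinates $U_1,\dots,U_{k-2},V_1,\dots,V_{k-1},W_1,W_2$. A vector field $\xi$ on $(\mathbb K^{2k-1},0)$ is liftable over $\varphi_k$ if there is a smooth (holomorphic when $\mathbb K=\mathbb C$) vector field $\eta$ on a neighbourhood of $0$ in $\mathbb K^{2k-2}$ such that $d\varphi_k\circ\eta=\xi\circ\varphi_k$ there. Put $U_{k-1}=V_k=0$, $U_k=1$, and $U_r=V_r=0$ for $r\le 0$ and for $r>k$. Write a vector field on $\mathbb K^{2k-1}$ as $(A_1,\dots,A_{k-2},B_1,\dots,B_{k-1},C_1,C_2)$, with components in the order of the coordinates above. Let $\xi_e$ be the Euler vector field, with $A_i=(k-i)U_i$,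 $B_i=(k-i)V_i$, $C_1=kW_1$, $C_2=kW_2$. For $1\le j\le k-1$ let $\xi^1_j,\xi^2_j,\xi^3_j$ be the vector fields with the following components, where $1\le i\le k-2$ in $A_i$ and $1\le i\le k-1$ in $B_i$. For $\xi^1_j$: \begin{align*} A_i&=(k-i)(k-j)U_iU_j,\\ B_i&=k\sum_{r=1}^{i-1}U_{i+j-r}V_r-k\sum_{r=1}^{i}U_rV_{i+j-r}-(i-1)(k-j)U_jV_i+kV_{i+j}W_1-kU_{i+j}W_2,\\ C_1&=k(k-j)U_jW_1,\\ C_2&=-kV_jW_1+(k-j)U_jW_2. \end{align*} For $\xi^2_j$: \begin{align*} A_i&=-k(k+i-j+1)U_{k+i-j+1}W_1+k\sum_{r=1}^i(k+i-j-2r+1)U_rU_{k+i-j-r+1}-j(i+1)U_{i+1}U_{k-j},\\ B_i&=-k(k+i-j+1)V_{k+i-j+1}W_1+k\sum_{r=1}^i(k+i-j-r+1)U_rV_{k+i-j-r+1}\\ &\qquad-k\sum_{r=1}^irU_{k+i-j-r+1}V_r-j(i+1)U_{k-j}V_{i+1},\\ C_1&=k(k-j+1)U_{k-j+1}W_1+jU_1U_{k-j},\\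 C_2&=k(k-j+1)V_{k-j+1}W_1+jV_1U_{k-j}. \end{align*} For $\xi^3_j$: \begin{align*} A_i&=-k(k+i-j+1)U_{k+i-j+1}W_2+k\sum_{r=1}^i(k+i-j-r+1)U_{k+i-j-r+1}V_r\\ &\qquad-k\sum_{r=1}^irU_rV_{k+i-j-r+1}-k(i+1)U_{i+1}V_{k-j},\\ B_i&=-k(k+i-j+1)V_{k+i-j+1}W_2+k\sum_{r=1}^i(k+i-j-2r+1)V_rV_{k+i-j-r+1}-k(i+1)V_{i+1}V_{k-j},\\ C_1&=k(k-j+1)U_{k-j+1}W_2+kU_1V_{k-j},\\ C_2&=k(k-j+1)V_{k-j+1}W_2+kV_1V_{k-j}. \end{align*} Let $\xi$ be a vector field on $\mathbb K^{2k-1}$ that is liftable over $\varphi_k$ and whose components are polynomials. Then there exist polynomials $g_e$ and $g_{i,j}$ ($1\le i\le 3$, $1\le j\le k-1$) in the target coordinates, with coefficients in $\mathbb K$, such that \[ \xi=g_e\,\xi_e+\sum_{i=1}^{3}\sum_{j=1}^{k-1}g_{i,j}\,\xi^i_j . \] -/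

import Mathlib

open scoped ContDiff

noncomputable section

namespace CrossCap

/-- A vector field `ξ` near the origin of `𝕜^τ` is liftable over (the germ at `0` of)
`f : 𝕜^σ → 𝕜^τ` if there is a smooth vector field `η` on an open neighbourhood of the origin of
`𝕜^σ` with `df ∘ η = ξ ∘ f` there. For `𝕜 = ℂ`, smooth means holomorphic. -/
def Liftable {𝕜 : Type*} [RCLike 𝕜] {σ τ : Type*} [Fintype σ] [Fintype τ]
    (f : (σ → 𝕜) → (τ → 𝕜)) (ξ : (τ → 𝕜) → (τ → 𝕜)) : Prop :=
  ∃ (N : Set (σ → 𝕜)) (η : (σ → 𝕜) → (σ → 𝕜)), IsOpen N ∧ 0 ∈ N ∧ ContDiffOn 𝕜 ∞ η N ∧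
    ∀ x ∈ N, fderiv 𝕜 f x (η x) = ξ (f x)

/-- Labels of the source coordinates `u_1, …, u_{k-2}`, `v_1, …, v_{k-1}`, `y`.
The element `i` of `Fin (k - 2)` or `Fin (k - 1)` labels the coordinate of index `i + 1`. -/
abbrev Src (k : ℕ) : Type := Fin (k - 2) ⊕ Fin (k - 1) ⊕ Unit

/-- Labels of the target coordinates `U_1, …, U_{k-2}`, `V_1, …, V_{k-1}`, `W_1, W_2`.
The element `i` of `Fin (k - 2)` or `Fin (k - 1)` labels the coordinate of index `i + 1`;
the elements `0` and `1` of `Fin 2` label `W_1` and `W_2`. -/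
abbrev Tgt (k : ℕ) : Type := Fin (k - 2) ⊕ Fin (k - 1) ⊕ Fin 2

/-- Polynomial functions on the target. -/
abbrev Poly (k : ℕ) (𝕜 : Type*) [RCLike 𝕜] : Type _ := MvPolynomial (Tgt k) 𝕜

/-- Vector fields with polynomial components on the target. -/
abbrev PolyField (k : ℕ) (𝕜 : Type*) [RCLike 𝕜] : Type _ := Tgt k → Poly k 𝕜

/-- The vector field, as a map, with the given polynomial components. -/
def PolyField.toFun {k : ℕ} {𝕜 : Type*} [RCLike 𝕜] (ξ : PolyField k 𝕜) :
    (Tgt k → 𝕜) → (Tgt k → 𝕜) :=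
  fun p t => MvPolynomial.eval p (ξ t)

/-- The vector field with components `A_1, …, A_{k-2}`, `B_1, …, B_{k-1}`, `C_1`, `C_2`. -/
def mkField {k : ℕ} {𝕜 : Type*} [RCLike 𝕜] (A B : ℕ → Poly k 𝕜) (C₁ C₂ : Poly k 𝕜) :
    PolyField k 𝕜
  | .inl i => A (i + 1)
  | .inr (.inl i) => B (i + 1)
  | .inr (.inr 0) => C₁
  | .inr (.inr 1) => C₂

section

variable (k : ℕ) (𝕜 : Type*) [RCLike 𝕜]

/-- The minimal cross cap mapping of multiplicity `k`. -/
def crossCap (x : Src k → 𝕜) : Tgt k → 𝕜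
  | .inl i => x (.inl i)
  | .inr (.inl i) => x (.inr (.inl i))
  | .inr (.inr 0) => x (.inr (.inr ())) ^ k +
      ∑ i : Fin (k - 2), x (.inl i) * x (.inr (.inr ())) ^ ((i : ℕ) + 1)
  | .inr (.inr 1) =>
      ∑ i : Fin (k - 1), x (.inr (.inl i)) * x (.inr (.inr ())) ^ ((i : ℕ) + 1)

/-- `U_r`, with the conventions `U_{k-1} = 0`, `U_k = 1`, `U_r = 0` for `r ≤ 0` and `r > k`. -/
def U (r : ℕ) : Poly k 𝕜 :=
  if h : 1 ≤ r ∧ r ≤ k - 2 then MvPolynomial.X (.inl ⟨r - 1, by omega⟩)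
  else if r = k then 1 else 0

/-- `V_r`, with the conventions `V_k = 0`, `V_r = 0` for `r ≤ 0` and `r > k`. -/
def V (r : ℕ) : Poly k 𝕜 :=
  if h : 1 ≤ r ∧ r ≤ k - 1 then MvPolynomial.X (.inr (.inl ⟨r - 1, by omega⟩)) else 0

/-- The coordinate `W_1`. -/
def W₁ : Poly k 𝕜 := MvPolynomial.X (.inr (.inr 0))

/-- The coordinate `W_2`. -/
def W₂ : Poly k 𝕜 := MvPolynomial.X (.inr (.inr 1))

/-- The Euler vector field of the cross cap mapping. -/
def eulerField : PolyField k 𝕜 :=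
  mkField (fun i => ((k : Poly k 𝕜) - i) * U k 𝕜 i) (fun i => ((k : Poly k 𝕜) - i) * V k 𝕜 i)
    (k * W₁ k 𝕜) (k * W₂ k 𝕜)

/-! In the three families `1 ≤ j ≤ k - 1`. The numerical coefficients are computed in the
polynomial ring; the subtractions in the subscripts are those of natural numbers, and there the
result is never negative because `j < k` and `r ≤ i`. -/

/-- The first family `ξ^1_j`. -/
def field₁ (j : ℕ) : PolyField k 𝕜 :=
  mkField
    (fun i => ((k : Poly k 𝕜) - i) * (k - j) * U k 𝕜 i * U k 𝕜 j)
    (fun i => k * ∑ r ∈ Finset.Icc 1 (i - 1), U k 𝕜 (i + j - r) * V k 𝕜 r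
      - k * ∑ r ∈ Finset.Icc 1 i, U k 𝕜 r * V k 𝕜 (i + j - r)
      - ((i : Poly k 𝕜) - 1) * (k - j) * U k 𝕜 j * V k 𝕜 i
      + k * V k 𝕜 (i + j) * W₁ k 𝕜 - k * U k 𝕜 (i + j) * W₂ k 𝕜)
    (k * ((k : Poly k 𝕜) - j) * U k 𝕜 j * W₁ k 𝕜)
    (-k * V k 𝕜 j * W₁ k 𝕜 + ((k : Poly k 𝕜) - j) * U k 𝕜 j * W₂ k 𝕜)

/-- The second family `ξ^2_j`. -/
def field₂ (j : ℕ) : PolyField k 𝕜 :=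
  mkField
    (fun i => -k * ((k : Poly k 𝕜) + i - j + 1) * U k 𝕜 (k + i - j + 1) * W₁ k 𝕜
      + k * ∑ r ∈ Finset.Icc 1 i,
          ((k : Poly k 𝕜) + i - j - 2 * r + 1) * U k 𝕜 r * U k 𝕜 (k + i - j - r + 1)
      - j * ((i : Poly k 𝕜) + 1) * U k 𝕜 (i + 1) * U k 𝕜 (k - j))
    (fun i => -k * ((k : Poly k 𝕜) + i - j + 1) * V k 𝕜 (k + i - j + 1) * W₁ k 𝕜
      + k * ∑ r ∈ Finset.Icc 1 i,
          ((k : Poly k 𝕜) + i - j - r + 1) * U k 𝕜 r * V k 𝕜 (k + i - j - r + 1)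
      - k * ∑ r ∈ Finset.Icc 1 i, (r : Poly k 𝕜) * U k 𝕜 (k + i - j - r + 1) * V k 𝕜 r
      - j * ((i : Poly k 𝕜) + 1) * U k 𝕜 (k - j) * V k 𝕜 (i + 1))
    (k * ((k : Poly k 𝕜) - j + 1) * U k 𝕜 (k - j + 1) * W₁ k 𝕜 + j * U k 𝕜 1 * U k 𝕜 (k - j))
    (k * ((k : Poly k 𝕜) - j + 1) * V k 𝕜 (k - j + 1) * W₁ k 𝕜 + j * V k 𝕜 1 * U k 𝕜 (k - j))

/-- The third family `ξ^3_j`. -/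
def field₃ (j : ℕ) : PolyField k 𝕜 :=
  mkField
    (fun i => -k * ((k : Poly k 𝕜) + i - j + 1) * U k 𝕜 (k + i - j + 1) * W₂ k 𝕜
      + k * ∑ r ∈ Finset.Icc 1 i,
          ((k : Poly k 𝕜) + i - j - r + 1) * U k 𝕜 (k + i - j - r + 1) * V k 𝕜 r
      - k * ∑ r ∈ Finset.Icc 1 i, (r : Poly k 𝕜) * U k 𝕜 r * V k 𝕜 (k + i - j - r + 1)
      - k * ((i : Poly k 𝕜) + 1) * U k 𝕜 (i + 1) * V k 𝕜 (k - j))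
    (fun i => -k * ((k : Poly k 𝕜) + i - j + 1) * V k 𝕜 (k + i - j + 1) * W₂ k 𝕜
      + k * ∑ r ∈ Finset.Icc 1 i,
          ((k : Poly k 𝕜) + i - j - 2 * r + 1) * V k 𝕜 r * V k 𝕜 (k + i - j - r + 1)
      - k * ((i : Poly k 𝕜) + 1) * V k 𝕜 (i + 1) * V k 𝕜 (k - j))
    (k * ((k : Poly k 𝕜) - j + 1) * U k 𝕜 (k - j + 1) * W₂ k 𝕜 + k * U k 𝕜 1 * V k 𝕜 (k - j))
    (k * ((k : Poly k 𝕜) - j + 1) * V k 𝕜 (k - j + 1) * W₂ k 𝕜 + k * V k 𝕜 1 * V k 𝕜 (k - j))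

/-- The fields `ξ^f_j`; the elements `0, 1, 2` of `Fin 3` label the first, second and third
family. -/
def family (f : Fin 3) (j : ℕ) : PolyField k 𝕜 :=
  ![field₁ k 𝕜 j, field₂ k 𝕜 j, field₃ k 𝕜 j] f

end

end CrossCap

end

/-! Write P = `polyU` and Q = `polyV` for the last two components of the map as polynomials in y,
and let `pull` substitute W₁ = P, W₂ = Q. The other components are coordinates, so a lift of ξ is
determined by its y-component h. Liftability becomes a pair of equations: `alpha` ξ = C₁ − ∑ A_i X^i
and `beta` ξ = C₂ − ∑ B_i X^i pull back to P'h and Q'h. The module `algLift` asks for a polynomial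
h.

From smooth to polynomial (`mem_algLift_of_liftable`): near 0 the pullback of `alpha` ξ vanishes
wherever P' does. P' is weighted homogeneous, so dilations carry this to all zeros of P', and P' is
simple enough (linear in U_1, or 2X when k = 2) for this to force divisibility
(`derivative_polyU_dvd`).

Generation (`algLift_le_genSpan`) is a division with remainder. The given fields lie in `algLift` by
identities between antisymmetric sums (`sum_comp`, `sum_swapComp`), so remainders stay in `algLift`.
The second and third families remove W₁ and W₂ from `alpha`. Combinations of generators with `alpha`
= 0 then remove W₂ from `beta`. For the remainder, `alpha` is its own pullback and has degree below
k − 1 = deg P', so h = 0 and `alpha` = 0. Now `beta` pulls back to 0, and 1, X, …, X^(k-1) are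
independent over 𝕜[U, V][P], so `beta` = 0. -/

open Polynomial

noncomputable section

namespace CrossCap

/-! ### Coefficient identities for antisymmetric sums of two sequences. -/

section Sequences

variable {S : Type*} [CommRing S] {k : ℕ} {a c : ℕ → S}

/-- The polynomial with coefficients `a 0, …, a k`. -/
def seqPoly (k : ℕ) (a : ℕ → S) : S[X] := ∑ i ∈ Finset.range (k + 1), C (a i) * X ^ i

lemma coeff_sum_range_C_mul_X_pow (N : ℕ) (a : ℕ → S) (n : ℕ) :
    (∑ i ∈ Finset.range N, C (a i) * X ^ i).coeff n = if n < N then a n else 0 := by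
  simp [coeff_C_mul, coeff_X_pow]

lemma coeff_seqPoly (ha : ∀ i, k < i → a i = 0) (n : ℕ) : (seqPoly k a).coeff n = a n := by
  rw [seqPoly, coeff_sum_range_C_mul_X_pow]
  split_ifs with h
  · rfl
  · rw [ha n (by omega)]

lemma sum_range_eq_seqPoly (hk : a k = 0) :
    ∑ i ∈ Finset.range k, C (a i) * X ^ i = seqPoly k a := by
  simp [seqPoly, Finset.sum_range_succ, hk]

lemma derivative_seqPoly (ha : ∀ i, k < i → a i = 0) :
    derivative (seqPoly k a) = ∑ i ∈ Finset.range k, C (((i : S) + 1) * a (i + 1)) * X ^ i := by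
  ext n
  rw [coeff_derivative, coeff_seqPoly ha, coeff_sum_range_C_mul_X_pow]
  split_ifs with h
  · ring
  · rw [ha (n + 1) (by omega), zero_mul]

lemma X_mul_derivative_seqPoly (ha : ∀ i, k < i → a i = 0) :
    X * derivative (seqPoly k a) = seqPoly k (fun i => i * a i) := by
  ext n
  rw [coeff_seqPoly fun i hi => by rw [ha i hi, mul_zero]]
  cases n with
  | zero => simp
  | succ n =>
    rw [coeff_X_mul, coeff_derivative, coeff_seqPoly ha]
    push_cast
    ring

/-- The antisymmetrised product of the terms of index `n - r` and `r` of two sequences. -/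
def wedge (a c : ℕ → S) (n r : ℕ) : S := a (n - r) * c r - a r * c (n - r)

lemma sum_wedge_range (a c : ℕ → S) (n : ℕ) :
    ∑ r ∈ Finset.range (n + 1), wedge a c n r = 0 := by
  simp only [wedge, Finset.sum_sub_distrib]
  rw [sub_eq_zero, ← Finset.sum_flip (fun r => a r * c (n - r))]
  refine Finset.sum_congr rfl fun r hr => ?_
  rw [Finset.mem_range] at hr
  rw [Nat.sub_sub_self (by omega)]

/-- The omitted terms vanish, so this is the complete sum, which is zero by the antisymmetry r ↦ n −
r. -/
lemma sum_wedge_Icc (ha : ∀ i, k < i → a i = 0) (hc : ∀ i, k < i → c i = 0) (ha0 : a 0 = 0)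
    {n i : ℕ} (hki : k ≤ i) (hin : i ≤ n) (hkn : k < n) :
    ∑ r ∈ Finset.Icc 1 i, wedge a c n r = 0 := by
  rw [← sum_wedge_range a c n]
  refine Finset.sum_subset (fun r hr => ?_) fun r hr hr' => ?_
  · simp only [Finset.mem_Icc, Finset.mem_range] at *
    omega
  · simp only [Finset.mem_Icc, Finset.mem_range, not_and_or, not_le] at *
    rcases hr' with h | h
    · obtain rfl : r = 0 := by omega
      simp [wedge, ha n hkn, ha0]
    · simp [wedge, ha r (by omega), hc r (by omega)]

/-- The right side is a convolution whose coefficient at X^n is the sum over 0 ≤ r ≤ n. Its term r =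
0 vanishes, and for n ≥ k the whole sum does by `sum_wedge_Icc`, so truncating the left side at k
loses nothing. -/
lemma sum_wedge_eq (ha : ∀ i, k < i → a i = 0) (hc : ∀ i, k < i → c i = 0) (ha0 : a 0 = 0)
    (hc0 : c 0 = 0) {m : ℕ} (hm : 1 ≤ m) :
    ∑ i ∈ Finset.range k, C (∑ r ∈ Finset.Icc 1 i, wedge a c (m + i) r) * X ^ i =
      seqPoly k c * seqPoly k (fun s => a (m + s)) -
        seqPoly k a * seqPoly k (fun s => c (m + s)) := by
  ext n
  have h₁ : (if n < k then ∑ r ∈ Finset.Icc 1 n, wedge a c (m + n) r else 0) =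
      ∑ r ∈ Finset.Icc 1 n, wedge a c (m + n) r := by
    split_ifs with h
    · rfl
    · rw [sum_wedge_Icc ha hc ha0 (by omega) (by omega) (by omega)]
  rw [coeff_sum_range_C_mul_X_pow, h₁, coeff_sub, coeff_mul, coeff_mul,
    Finset.Nat.sum_antidiagonal_eq_sum_range_succ_mk,
    Finset.Nat.sum_antidiagonal_eq_sum_range_succ_mk, ← Finset.sum_sub_distrib]
  refine Finset.sum_subset_zero_on_sdiff (fun r hr => ?_) (fun r hr => ?_) (fun r hr => ?_)
  · simp only [Finset.mem_Icc, Finset.mem_range] at *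
    omega
  · obtain rfl : r = 0 := by
      simp only [Finset.mem_sdiff, Finset.mem_Icc, Finset.mem_range] at hr
      omega
    simp only [coeff_seqPoly ha, coeff_seqPoly hc, hc0, ha0]
    simp
  · rw [Finset.mem_Icc] at hr
    simp only [coeff_seqPoly ha, coeff_seqPoly hc]
    rw [coeff_seqPoly (fun i hi => ha _ (by omega)), coeff_seqPoly (fun i hi => hc _ (by omega)),
      wedge, Nat.add_sub_assoc hr.2]
    ring

/-- The common form of the components of the second and third families. -/
def comp (k : ℕ) (a c : ℕ → S) (w l : S) (m i : ℕ) : S :=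
  -k * ((m + i : ℕ) : S) * a (m + i) * w + k * ∑ r ∈ Finset.Icc 1 i, wedge (fun s => s * a s) c (m + i) r
    - l * ((i : S) + 1) * a (i + 1)

lemma comp_eq {j : ℕ} (hj : j < k) (w l : S) (i : ℕ) :
    comp k a c w l (k - j + 1) i = -k * ((k : S) + i - j + 1) * a (k + i - j + 1) * w
      + k * ∑ r ∈ Finset.Icc 1 i, (((k : S) + i - j - r + 1) * a (k + i - j - r + 1) * c r
        - r * a r * c (k + i - j - r + 1))
      - l * ((i : S) + 1) * a (i + 1) := by
  have h₁ : ((k - j + 1 + i : ℕ) : S) = k + i - j + 1 := by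
    push_cast [Nat.cast_sub hj.le]
    ring
  rw [comp, h₁, show k - j + 1 + i = k + i - j + 1 by omega]
  congr 3
  refine Finset.sum_congr rfl fun r hr => ?_
  rw [Finset.mem_Icc] at hr
  rw [wedge, Nat.cast_sub (by omega), show k + i - j + 1 = k - j + 1 + i by omega, h₁,
    show k - j + 1 + i - r = k + i - j - r + 1 by omega]
  ring

lemma comp_self {j : ℕ} (hj : j < k) (w l : S) (i : ℕ) :
    comp k a a w l (k - j + 1) i = -k * ((k : S) + i - j + 1) * a (k + i - j + 1) * w
      + k * ∑ r ∈ Finset.Icc 1 i, ((k : S) + i - j - 2 * r + 1) * a r * a (k + i - j - r + 1)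
      - l * ((i : S) + 1) * a (i + 1) := by
  rw [comp_eq hj]
  congr 3
  exact Finset.sum_congr rfl fun r _ => by ring

lemma comp_eq_sub {j : ℕ} (hj : j < k) (w l : S) (i : ℕ) :
    comp k a c w l (k - j + 1) i = -k * ((k : S) + i - j + 1) * a (k + i - j + 1) * w
      + k * ∑ r ∈ Finset.Icc 1 i, ((k : S) + i - j - r + 1) * a (k + i - j - r + 1) * c r
      - k * ∑ r ∈ Finset.Icc 1 i, (r : S) * a r * c (k + i - j - r + 1)
      - l * ((i : S) + 1) * a (i + 1) := by
  rw [comp_eq hj, Finset.sum_sub_distrib]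
  ring

lemma neg_comp_zero {j : ℕ} (hj : j < k) (w l : S) :
    -comp k a c w l (k - j + 1) 0 =
      k * ((k : S) - j + 1) * a (k - j + 1) * w + l * a 1 := by
  rw [comp_eq hj]
  simp [add_comm]

/-- There is no coordinate U_{k-1}, so the component that would belong to it must vanish. This
dictates the value of l: the sum up to k is zero, hence the sum up to k − 1 is minus its term r = k.
-/
lemma comp_last (ha : ∀ i, k < i → a i = 0) (hc : ∀ i, k < i → c i = 0) (hak : a k = 1)
    {j : ℕ} (hjk : j < k) (w l : S)
    (hl : l = k * c (k - j) - ((k - j : ℕ) : S) * a (k - j) * c k) :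
    comp k a c w l (k - j + 1) (k - 1) = 0 := by
  have h := sum_wedge_Icc (a := fun s => s * a s) (fun i hi => by simp only [ha i hi, mul_zero]) hc
    (by simp) (le_refl k) (n := 2 * k - j) (by omega) (by omega)
  have hk : k = (k - 1) + 1 := by omega
  rw [hk, Finset.sum_Icc_succ_top (by omega), ← hk] at h
  have hkS : ((k - 1 : ℕ) : S) + 1 = k := by
    rw [← Nat.cast_succ, Nat.succ_eq_add_one, ← hk]
  rw [comp, show k - j + 1 + (k - 1) = 2 * k - j by omega, ha (2 * k - j) (by omega),
    eq_neg_of_add_eq_zero_left h, hkS, ← hk, wedge, hak,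
    show 2 * k - j - k = k - j by omega, hl]
  ring

/-- Applied with F = `pull`. Since w pulls back to the polynomial of c, the first term of `comp`
cancels one of the two products in `sum_wedge_eq`, and the other is a multiple of the derivative.
The cofactor does not involve a, so U and V share the same h. -/
lemma sum_comp {Φ : Type*} [FunLike Φ S S[X]] [RingHomClass Φ S S[X]] (F : Φ)
    (ha : ∀ i, k < i → a i = 0) (hc : ∀ i, k < i → c i = 0) (hc0 : c 0 = 0)
    (hFa : ∀ i, F (a i) = C (a i)) (hFc : ∀ i, F (c i) = C (c i)) {m : ℕ}
    (hm : 1 ≤ m) {w l : S} (hw : F w = seqPoly k c) (hl : F l = C l) :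
    -∑ i ∈ Finset.range k, F (comp k a c w l m i) * X ^ i =
      derivative (seqPoly k a) * (C (k : S) * X * seqPoly k (fun s => c (m + s)) + C l) := by
  have h₁ : ∀ i, F (comp k a c w l m i) * X ^ i =
      -(C (k : S) * seqPoly k c) * (C (((m + i : ℕ) : S) * a (m + i)) * X ^ i) +
      C (k : S) * (C (∑ r ∈ Finset.Icc 1 i, wedge (fun s => s * a s) c (m + i) r) * X ^ i) -
      C l * (C (((i : S) + 1) * a (i + 1)) * X ^ i) := by
    intro i
    simp only [comp, wedge, map_add, map_sub, map_mul, map_neg, map_natCast, map_sum, hFa, hFc,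
      hw, hl, map_one]
    ring
  simp only [h₁, Finset.sum_sub_distrib, Finset.sum_add_distrib, ← Finset.mul_sum]
  rw [sum_wedge_eq (fun i hi => by rw [ha i hi, mul_zero]) hc (by simp) hc0 hm,
    ← X_mul_derivative_seqPoly ha, ← derivative_seqPoly ha,
    sum_range_eq_seqPoly (a := fun i => ((m + i : ℕ) : S) * a (m + i))
      (by simp only [ha (m + k) (by omega), mul_zero])]
  ring

lemma euler_seqPoly (ha : ∀ i, k < i → a i = 0) :
    C (k : S) * seqPoly k a - ∑ i ∈ Finset.range k, C (((k : S) - i) * a i) * X ^ i =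
      derivative (seqPoly k a) * X := by
  rw [mul_comm _ X, X_mul_derivative_seqPoly ha]
  ext n
  rw [coeff_sub, coeff_C_mul, coeff_seqPoly ha, coeff_sum_range_C_mul_X_pow,
    coeff_seqPoly fun i hi => by rw [ha i hi, mul_zero]]
  split_ifs with h
  · ring
  · rcases eq_or_lt_of_le (not_lt.1 h) with rfl | h
    · ring
    · simp [ha n h]

/-- The form of the components `B_i` of the first family. -/
def swapComp (k : ℕ) (a c : ℕ → S) (w₁ w₂ s : S) (j i : ℕ) : S :=
  k * ∑ r ∈ Finset.Icc 1 (i - 1), a (i + j - r) * c r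
    - k * ∑ r ∈ Finset.Icc 1 i, a r * c (i + j - r)
    - ((i : S) - 1) * s * c i + k * c (i + j) * w₁ - k * a (i + j) * w₂

/-- The first sum stops at i − 1; completing it to an antisymmetric sum costs the term k a_j c_i. -/
lemma swapComp_eq (hc0 : c 0 = 0) (w₁ w₂ s : S) (j i : ℕ) : swapComp k a c w₁ w₂ s j i =
    k * ∑ r ∈ Finset.Icc 1 i, wedge a c (j + i) r - k * a j * c i - ((i : S) - 1) * s * c i
      + k * c (j + i) * w₁ - k * a (j + i) * w₂ := by
  have h : ∑ r ∈ Finset.Icc 1 (i - 1), a (j + i - r) * c r =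
      ∑ r ∈ Finset.Icc 1 i, a (j + i - r) * c r - a j * c i := by
    cases i with
    | zero => simp [hc0]
    | succ i =>
      rw [Finset.sum_Icc_succ_top (by omega), Nat.add_sub_cancel, Nat.add_sub_cancel,
        add_sub_cancel_right]
  simp only [swapComp, wedge, Finset.sum_sub_distrib]
  rw [add_comm i j, h]
  ring

lemma sum_swapComp {Φ : Type*} [FunLike Φ S S[X]] [RingHomClass Φ S S[X]] (F : Φ)
    (ha : ∀ i, k < i → a i = 0) (hc : ∀ i, k ≤ i → c i = 0) (ha0 : a 0 = 0) (hc0 : c 0 = 0)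
    (hFa : ∀ i, F (a i) = C (a i)) (hFc : ∀ i, F (c i) = C (c i)) {j : ℕ} (hj : 1 ≤ j)
    {w₁ w₂ s : S} (hw₁ : F w₁ = seqPoly k a) (hw₂ : F w₂ = seqPoly k c) (hs : F s = C s) :
    F (-k * c j * w₁ + s * w₂ + swapComp k a c w₁ w₂ s j 0) -
      ∑ i ∈ Finset.range k, F (swapComp k a c w₁ w₂ s j i) * X ^ i =
      derivative (seqPoly k c) * (C s * X) := by
  have hc' : ∀ i, k < i → c i = 0 := fun i hi => hc i hi.le
  have h₁ : ∀ i, F (swapComp k a c w₁ w₂ s j i) * X ^ i =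
      C (k : S) * (C (∑ r ∈ Finset.Icc 1 i, wedge a c (j + i) r) * X ^ i) -
      C (k : S) * C (a j) * (C (c i) * X ^ i) - C s * (C (i * c i) * X ^ i) +
      C s * (C (c i) * X ^ i) + C (k : S) * seqPoly k a * (C (c (j + i)) * X ^ i) -
      C (k : S) * seqPoly k c * (C (a (j + i)) * X ^ i) := by
    intro i
    simp only [swapComp_eq hc0, wedge, map_add, map_sub, map_mul, map_natCast, map_sum, hFa, hFc,
      hw₁, hw₂, hs, map_one]
    ring
  simp only [h₁, Finset.sum_sub_distrib, Finset.sum_add_distrib, ← Finset.mul_sum]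
  rw [sum_wedge_eq ha hc' ha0 hc0 hj, sum_range_eq_seqPoly (hc k le_rfl),
    sum_range_eq_seqPoly (a := fun i => (i : S) * c i) (by simp only [hc k le_rfl, mul_zero]),
    ← X_mul_derivative_seqPoly hc', sum_range_eq_seqPoly (a := fun i => c (j + i)) (hc _ (by omega)),
    sum_range_eq_seqPoly (a := fun i => a (j + i)) (ha _ (by omega)), swapComp_eq hc0]
  simp only [map_add, map_sub, map_mul, map_neg, map_natCast, hFa, hFc, hw₁, hw₂, hs,
    hc0, add_zero, Finset.Icc_eq_empty_of_lt Nat.zero_lt_one, Finset.sum_empty, map_zero]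
  ring

end Sequences

/-! ### Eliminating variables from coefficients by a triangular system. -/

section Reduction

variable {𝕜 S : Type*} [Field 𝕜] [CommRing S] [Algebra 𝕜 S]

/-- The polynomials of degree less than `n` with coefficients in the subalgebra `T`. -/
def coeffsIn (T : Subalgebra 𝕜 S) (n : ℕ) : Submodule T S[X] where
  carrier := {f | ∀ i, f.coeff i ∈ T ∧ (n ≤ i → f.coeff i = 0)}
  add_mem' {f g} hf hg i := by
    refine ⟨by rw [coeff_add]; exact add_mem (hf i).1 (hg i).1, fun h => ?_⟩
    rw [coeff_add, (hf i).2 h, (hg i).2 h, add_zero]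
  zero_mem' i := by simp
  smul_mem' t f hf i := by
    refine ⟨by rw [coeff_smul]; exact T.mul_mem t.2 (hf i).1, fun h => ?_⟩
    rw [coeff_smul, (hf i).2 h, smul_zero]

lemma eq_sum_of_coeff_eq_zero {n : ℕ} {f : S[X]} (hf : ∀ i, n ≤ i → f.coeff i = 0) :
    f = ∑ i ∈ Finset.range n, f.coeff i • (X ^ i : S[X]) := by
  ext i
  simp only [smul_eq_C_mul]
  rw [coeff_sum_range_C_mul_X_pow n f.coeff]
  split_ifs with h
  · rfl
  · exact hf i (by omega)

/-- If, modulo a submodule and the polynomials with coefficients in `T`, each element of a set of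
generators `Ws` of the ring over `T` annihilates a triangular system of polynomials of degrees
`0, …, n - 1`, then every polynomial of degree less than `n` is congruent modulo the submodule to
one with coefficients in `T`. -/
lemma exists_sub_mem_coeffsIn (T : Subalgebra 𝕜 S) (Ws : Set S)
    (hT : Algebra.adjoin 𝕜 ((T : Set S) ∪ Ws) = ⊤) (n : ℕ) (M : Submodule S S[X])
    (hW : ∀ w ∈ Ws, ∀ d < n, ∃ H ∈ coeffsIn T (d + 1), ∃ b : 𝕜, b ≠ 0 ∧
      H.coeff d = algebraMap 𝕜 S b ∧ ∃ ζ ∈ M, ζ - w • H ∈ coeffsIn T n)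
    {f : S[X]} (hf : ∀ i, n ≤ i → f.coeff i = 0) : ∃ ζ ∈ M, f - ζ ∈ coeffsIn T n := by
  -- A priori E is only a T-module. Once it is stable under `Ws` it is stable under all of S, and
  -- since it contains 1, …, X^(n-1) it contains f.
  set E : Submodule T S[X] := M.restrictScalars T ⊔ coeffsIn T n with hE
  have hLE : coeffsIn T n ≤ E := le_sup_right
  have hME : ∀ ζ ∈ M, ζ ∈ E := fun ζ h => (le_sup_left : M.restrictScalars T ≤ E) h
  have hsmul : ∀ (t : S) (_ : t ∈ T) (g : S[X]), g ∈ E → t • g ∈ E :=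
    fun t ht g hg => E.smul_mem ⟨t, ht⟩ hg
  have hX : ∀ d < n, (X ^ d : S[X]) ∈ E := fun d hd => hLE fun i => by
    rw [coeff_X_pow]
    split_ifs with h
    · exact ⟨one_mem _, fun h' => by omega⟩
    · exact ⟨zero_mem _, fun _ => rfl⟩
  have hwX : ∀ w ∈ Ws, ∀ d < n, w • (X ^ d : S[X]) ∈ E := by
    intro w hw d
    induction d using Nat.strong_induction_on with
    | _ d ih =>
      intro hd
      obtain ⟨H, hH, b, hb, hHb, ζ, hζ, hζH⟩ := hW w hw d hd
      have h₁ : w • H ∈ E := by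
        rw [← sub_sub_cancel ζ (w • H)]
        exact sub_mem (hME ζ hζ) (hLE hζH)
      have h₂ := eq_sum_of_coeff_eq_zero fun i hi => (hH i).2 hi
      rw [Finset.sum_range_succ, hHb] at h₂
      -- The coefficient of H at d is a nonzero scalar, so w • H can be solved for w • X^d in terms
      -- of lower powers.
      have h₃ : w • (X ^ d : S[X]) = algebraMap 𝕜 S b⁻¹ •
          (w • H - ∑ i ∈ Finset.range d, H.coeff i • w • (X ^ i : S[X])) := by
        have h₄ : w • H = ∑ i ∈ Finset.range d, H.coeff i • w • (X ^ i : S[X]) +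
            algebraMap 𝕜 S b • w • X ^ d := by
          conv_lhs => rw [h₂]
          rw [smul_add, Finset.smul_sum, smul_comm w (algebraMap 𝕜 S b)]
          simp only [smul_comm w (H.coeff _)]
        rw [h₄, add_sub_cancel_left, smul_smul, ← map_mul, inv_mul_cancel₀ hb, map_one, one_smul]
      rw [h₃]
      refine hsmul _ (T.algebraMap_mem _) _ (sub_mem h₁ (sum_mem fun i hi => ?_))
      rw [Finset.mem_range] at hi
      exact hsmul _ (hH i).1 _ (ih i hi (by omega))
  have hwE : ∀ w ∈ Ws, ∀ g ∈ E, w • g ∈ E := by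
    intro w hw g hg
    obtain ⟨ζ, hζ, l, hl, rfl⟩ := Submodule.mem_sup.1 hg
    rw [smul_add]
    refine add_mem (hME _ (M.smul_mem w hζ)) ?_
    rw [eq_sum_of_coeff_eq_zero fun i hi => (hl i).2 hi, Finset.smul_sum]
    refine sum_mem fun i hi => ?_
    rw [smul_comm]
    exact hsmul _ (hl i).1 _ (hwX w hw i (Finset.mem_range.1 hi))
  have hall : ∀ s : S, ∀ g ∈ E, s • g ∈ E := by
    intro s
    have hs : s ∈ Algebra.adjoin 𝕜 ((T : Set S) ∪ Ws) := hT ▸ Algebra.mem_top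
    induction hs using Algebra.adjoin_induction with
    | mem x hx =>
      rcases hx with hx | hx
      · exact hsmul x hx
      · exact hwE x hx
    | algebraMap r => exact hsmul _ (T.algebraMap_mem r)
    | add x y _ _ hx hy => exact fun g hg => by rw [add_smul]; exact add_mem (hx g hg) (hy g hg)
    | mul x y _ _ hx hy => exact fun g hg => by rw [mul_smul]; exact hx _ (hy g hg)
  have hfE : f ∈ E := by
    rw [eq_sum_of_coeff_eq_zero hf]
    exact sum_mem fun i hi => hall _ _ (hX i (Finset.mem_range.1 hi))
  obtain ⟨ζ, hζ, l, hl, rfl⟩ := Submodule.mem_sup.1 hfE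
  exact ⟨ζ, hζ, by rwa [add_sub_cancel_left]⟩

end Reduction

/-! ### Vector fields as pairs of polynomials; polynomial lifts of the second and third families. -/

section Fields

variable {k : ℕ} {𝕜 : Type*} [RCLike 𝕜]

lemma U_zero (hk : 2 ≤ k) : U k 𝕜 0 = 0 := by
  rw [U, dif_neg (by omega), if_neg (by omega)]

lemma U_self : U k 𝕜 k = 1 := by
  rw [U, dif_neg (by omega), if_pos rfl]

lemma U_pred (hk : 2 ≤ k) : U k 𝕜 (k - 1) = 0 := by
  rw [U, dif_neg (by omega), if_neg (by omega)]

lemma U_of_lt (r : ℕ) (h : k < r) : U k 𝕜 r = 0 := by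
  rw [U, dif_neg (by omega), if_neg (by omega)]

lemma V_zero : V k 𝕜 0 = 0 := by
  rw [V, dif_neg (by omega)]

lemma V_of_le (r : ℕ) (hk : 2 ≤ k) (h : k ≤ r) : V k 𝕜 r = 0 := by
  rw [V, dif_neg (by omega)]

variable (k 𝕜) in
/-- The monic polynomial `X ^ k + ∑ U_i X ^ i`. -/
def polyU : (Poly k 𝕜)[X] := seqPoly k (U k 𝕜)

variable (k 𝕜) in
/-- The polynomial `∑ V_i X ^ i`. -/
def polyV : (Poly k 𝕜)[X] := seqPoly k (V k 𝕜)

variable (k 𝕜) in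
/-- Substitution of the cross cap mapping in a polynomial on the target; the variable `X` plays
the role of the source coordinate `y`. -/
def pull : Poly k 𝕜 →ₐ[𝕜] (Poly k 𝕜)[X] :=
  MvPolynomial.aeval fun t => match t with
    | .inl i => C (MvPolynomial.X (.inl i))
    | .inr (.inl i) => C (MvPolynomial.X (.inr (.inl i)))
    | .inr (.inr 0) => polyU k 𝕜
    | .inr (.inr 1) => polyV k 𝕜

@[simp] lemma pull_W₁ : pull k 𝕜 (W₁ k 𝕜) = polyU k 𝕜 := by simp [pull, W₁]

@[simp] lemma pull_W₂ : pull k 𝕜 (W₂ k 𝕜) = polyV k 𝕜 := by simp [pull, W₂]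

@[simp] lemma pull_U (r : ℕ) : pull k 𝕜 (U k 𝕜 r) = C (U k 𝕜 r) := by
  unfold U
  split_ifs <;> simp [pull]

@[simp] lemma pull_V (r : ℕ) : pull k 𝕜 (V k 𝕜 r) = C (V k 𝕜 r) := by
  unfold V
  split_ifs <;> simp [pull]

variable (k 𝕜) in
/-- The extension of `pull` to polynomials in `X`. -/
def pullPoly : (Poly k 𝕜)[X] →+* (Poly k 𝕜)[X] := eval₂RingHom (pull k 𝕜 : _ →+* _) X

@[simp] lemma pullPoly_C (s : Poly k 𝕜) : pullPoly k 𝕜 (C s) = pull k 𝕜 s := by simp [pullPoly]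

@[simp] lemma pullPoly_X : pullPoly k 𝕜 X = X := by simp [pullPoly]

lemma pullPoly_smul (s : Poly k 𝕜) (f : (Poly k 𝕜)[X]) :
    pullPoly k 𝕜 (s • f) = pull k 𝕜 s * pullPoly k 𝕜 f := by
  rw [smul_eq_C_mul, map_mul, pullPoly_C]

variable (k 𝕜) in
/-- The polynomial `C₁ - ∑ A_i X ^ i` of a vector field. -/
def alpha : PolyField k 𝕜 →ₗ[Poly k 𝕜] (Poly k 𝕜)[X] where
  toFun ξ := C (ξ (.inr (.inr 0))) - ∑ i : Fin (k - 2), C (ξ (.inl i)) * X ^ ((i : ℕ) + 1)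
  map_add' ξ ζ := by
    simp only [Pi.add_apply, map_add, add_mul, Finset.sum_add_distrib]
    ring
  map_smul' s ξ := by
    simp only [Pi.smul_apply, smul_eq_mul, map_mul, mul_assoc, ← Finset.mul_sum, smul_eq_C_mul,
      RingHom.id_apply]
    ring

variable (k 𝕜) in
/-- The polynomial `C₂ - ∑ B_i X ^ i` of a vector field. -/
def beta : PolyField k 𝕜 →ₗ[Poly k 𝕜] (Poly k 𝕜)[X] where
  toFun ξ := C (ξ (.inr (.inr 1))) - ∑ i : Fin (k - 1), C (ξ (.inr (.inl i))) * X ^ ((i : ℕ) + 1)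
  map_add' ξ ζ := by
    simp only [Pi.add_apply, map_add, add_mul, Finset.sum_add_distrib]
    ring
  map_smul' s ξ := by
    simp only [Pi.smul_apply, smul_eq_mul, map_mul, mul_assoc, ← Finset.mul_sum, smul_eq_C_mul,
      RingHom.id_apply]
    ring

lemma alpha_apply (ξ : PolyField k 𝕜) : alpha k 𝕜 ξ =
    C (ξ (.inr (.inr 0))) - ∑ i : Fin (k - 2), C (ξ (.inl i)) * X ^ ((i : ℕ) + 1) := rfl

lemma beta_apply (ξ : PolyField k 𝕜) : beta k 𝕜 ξ =
    C (ξ (.inr (.inr 1))) - ∑ i : Fin (k - 1), C (ξ (.inr (.inl i))) * X ^ ((i : ℕ) + 1) := rfl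

lemma coeff_C_sub_sum {S : Type*} [CommRing S] {N : ℕ} (c : S) (f : Fin N → S) (n : ℕ) :
    (C c - ∑ i : Fin N, C (f i) * X ^ ((i : ℕ) + 1)).coeff n =
      if n = 0 then c else if h : n - 1 < N then -f ⟨n - 1, h⟩ else 0 := by
  rw [coeff_sub, coeff_C, finsetSum_coeff]
  simp only [coeff_C_mul, coeff_X_pow]
  split_ifs with h₀ h
  · subst h₀
    simp
  · rw [Finset.sum_eq_single (⟨n - 1, h⟩ : Fin N)]
    · rw [if_pos (by simp only; omega)]
      ring
    · intro b _ hb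
      rw [if_neg, mul_zero]
      rintro rfl
      exact hb (Fin.ext (by simp))
    · simp
  · rw [Finset.sum_eq_zero, sub_zero]
    intro b _
    rw [if_neg (by omega), mul_zero]

lemma coeff_alpha (ξ : PolyField k 𝕜) (n : ℕ) : (alpha k 𝕜 ξ).coeff n =
    if n = 0 then ξ (.inr (.inr 0)) else if h : n - 1 < k - 2 then -ξ (.inl ⟨n - 1, h⟩) else 0 :=
  coeff_C_sub_sum _ _ n

lemma coeff_beta (ξ : PolyField k 𝕜) (n : ℕ) : (beta k 𝕜 ξ).coeff n =
    if n = 0 then ξ (.inr (.inr 1))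
    else if h : n - 1 < k - 1 then -ξ (.inr (.inl ⟨n - 1, h⟩)) else 0 :=
  coeff_C_sub_sum _ _ n

lemma eq_zero_of_alpha_of_beta {ξ : PolyField k 𝕜} (hα : alpha k 𝕜 ξ = 0)
    (hβ : beta k 𝕜 ξ = 0) : ξ = 0 := by
  have h₁ := fun n => (coeff_alpha ξ n).symm.trans (by rw [hα, coeff_zero])
  have h₂ := fun n => (coeff_beta ξ n).symm.trans (by rw [hβ, coeff_zero])
  funext t
  rcases t with i | i | i
  · have h := h₁ (i + 1)
    rw [if_neg (by omega), dif_pos (by omega), neg_eq_zero] at h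
    exact h
  · have h := h₂ (i + 1)
    rw [if_neg (by omega), dif_pos (by omega), neg_eq_zero] at h
    exact h
  · fin_cases i
    · simpa using h₁ 0
    · simpa using h₂ 0

lemma coeff_alpha_mkField (A B : ℕ → Poly k 𝕜) (C₁ C₂ : Poly k 𝕜) (n : ℕ) :
    (alpha k 𝕜 (mkField A B C₁ C₂)).coeff n =
      if n = 0 then C₁ else if n < k - 1 then -A n else 0 := by
  rw [coeff_alpha]
  split_ifs with h₀ h₁ h₂ h₂
  · rfl
  · simp only [mkField]
    rw [Nat.sub_add_cancel (by omega)]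
  · omega
  · omega
  · rfl

lemma coeff_beta_mkField (A B : ℕ → Poly k 𝕜) (C₁ C₂ : Poly k 𝕜) (n : ℕ) :
    (beta k 𝕜 (mkField A B C₁ C₂)).coeff n =
      if n = 0 then C₂ else if n < k then -B n else 0 := by
  rw [coeff_beta]
  split_ifs with h₀ h₁ h₂ h₂
  · rfl
  · simp only [mkField]
    rw [Nat.sub_add_cancel (by omega)]
  · omega
  · omega
  · rfl

lemma pullPoly_alpha (ξ : PolyField k 𝕜) : pullPoly k 𝕜 (alpha k 𝕜 ξ) =
    pull k 𝕜 (ξ (.inr (.inr 0))) - ∑ i : Fin (k - 2), pull k 𝕜 (ξ (.inl i)) * X ^ ((i : ℕ) + 1) := by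
  simp [alpha_apply]

lemma pullPoly_beta (ξ : PolyField k 𝕜) : pullPoly k 𝕜 (beta k 𝕜 ξ) =
    pull k 𝕜 (ξ (.inr (.inr 1))) -
      ∑ i : Fin (k - 1), pull k 𝕜 (ξ (.inr (.inl i))) * X ^ ((i : ℕ) + 1) := by
  simp [beta_apply]

/-- The sum is extended to all indices below k: index k − 1 contributes nothing, and index 0 is
compensated by adding A_0 to C₁. -/
lemma pullPoly_alpha_mkField (hk : 2 ≤ k) (A B : ℕ → Poly k 𝕜) (C₁ C₂ : Poly k 𝕜)
    (hA : A (k - 1) = 0) : pullPoly k 𝕜 (alpha k 𝕜 (mkField A B C₁ C₂)) =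
      pull k 𝕜 (C₁ + A 0) - ∑ i ∈ Finset.range k, pull k 𝕜 (A i) * X ^ i := by
  obtain ⟨k, rfl⟩ := Nat.exists_eq_add_of_le' hk
  rw [pullPoly_alpha, Finset.sum_range_succ, Finset.sum_range_succ']
  rw [show k + 2 - 1 = k + 1 from rfl] at hA
  simp only [mkField, hA, map_zero, map_add]
  rw [Fin.sum_univ_eq_sum_range (fun i => pull (k + 2) 𝕜 (A (i + 1)) * X ^ (i + 1)),
    Nat.add_sub_cancel]
  ring

lemma pullPoly_beta_mkField (hk : 2 ≤ k) (A B : ℕ → Poly k 𝕜) (C₁ C₂ : Poly k 𝕜) :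
    pullPoly k 𝕜 (beta k 𝕜 (mkField A B C₁ C₂)) =
      pull k 𝕜 (C₂ + B 0) - ∑ i ∈ Finset.range k, pull k 𝕜 (B i) * X ^ i := by
  obtain ⟨k, rfl⟩ := Nat.exists_eq_add_of_le' hk
  rw [pullPoly_beta, Finset.sum_range_succ']
  simp only [mkField, map_add]
  rw [Fin.sum_univ_eq_sum_range (fun i => pull (k + 2) 𝕜 (B (i + 1)) * X ^ (i + 1)),
    show k + 2 - 1 = k + 1 from rfl]
  ring

variable (k 𝕜) in
/-- The polynomial vector fields with a polynomial lift over the cross cap mapping. -/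
def algLift : Submodule (Poly k 𝕜) (PolyField k 𝕜) where
  carrier := {ξ | ∃ h, pullPoly k 𝕜 (alpha k 𝕜 ξ) = derivative (polyU k 𝕜) * h ∧
    pullPoly k 𝕜 (beta k 𝕜 ξ) = derivative (polyV k 𝕜) * h}
  add_mem' := by
    rintro ξ ζ ⟨h, h₁, h₂⟩ ⟨h', h₁', h₂'⟩
    refine ⟨h + h', ?_, ?_⟩
    · rw [map_add, map_add, h₁, h₁', mul_add]
    · rw [map_add, map_add, h₂, h₂', mul_add]
  zero_mem' := ⟨0, by simp, by simp⟩
  smul_mem' := by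
    rintro s ξ ⟨h, h₁, h₂⟩
    refine ⟨pull k 𝕜 s * h, ?_, ?_⟩
    · rw [map_smul, pullPoly_smul, h₁]
      ring
    · rw [map_smul, pullPoly_smul, h₂]
      ring

/-- The common form of the second and third families. -/
def compField (c : ℕ → Poly k 𝕜) (w l : Poly k 𝕜) (m : ℕ) : PolyField k 𝕜 :=
  mkField (comp k (U k 𝕜) c w l m) (comp k (V k 𝕜) c w l m)
    (-comp k (U k 𝕜) c w l m 0) (-comp k (V k 𝕜) c w l m 0)

lemma mkField_congr {A A' B B' : ℕ → Poly k 𝕜} {C₁ C₁' C₂ C₂' : Poly k 𝕜}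
    (hA : ∀ i, A i = A' i) (hB : ∀ i, B i = B' i) (h₁ : C₁ = C₁') (h₂ : C₂ = C₂') :
    mkField A B C₁ C₂ = mkField A' B' C₁' C₂' := by
  rw [funext hA, funext hB, h₁, h₂]

lemma field₂_eq {j : ℕ} (hj : j < k) :
    field₂ k 𝕜 j = compField (U k 𝕜) (W₁ k 𝕜) (j * U k 𝕜 (k - j)) (k - j + 1) := by
  refine mkField_congr (fun i => ?_) (fun i => ?_) ?_ ?_
  · rw [comp_self hj]
    ring
  · rw [comp_eq_sub hj]
    simp only [mul_right_comm _ (V k 𝕜 _) (U k 𝕜 _)]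
    ring
  · rw [neg_comp_zero hj]
    ring
  · rw [neg_comp_zero hj]
    ring

lemma field₃_eq {j : ℕ} (hj : j < k) :
    field₃ k 𝕜 j = compField (V k 𝕜) (W₂ k 𝕜) (k * V k 𝕜 (k - j)) (k - j + 1) := by
  refine mkField_congr (fun i => ?_) (fun i => ?_) ?_ ?_
  · rw [comp_eq_sub hj]
    ring
  · rw [comp_self hj]
    ring
  · rw [neg_comp_zero hj]
    ring
  · rw [neg_comp_zero hj]
    ring

lemma compField_mem_algLift (hk : 2 ≤ k) {c : ℕ → Poly k 𝕜} (hc : ∀ i, k < i → c i = 0)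
    (hc0 : c 0 = 0) (hpc : ∀ i, pull k 𝕜 (c i) = C (c i)) {w l : Poly k 𝕜}
    (hw : pull k 𝕜 w = seqPoly k c) (hl : pull k 𝕜 l = C l) {j : ℕ} (hj : j < k)
    (hlc : l = k * c (k - j) - ((k - j : ℕ) : Poly k 𝕜) * U k 𝕜 (k - j) * c k) :
    compField c w l (k - j + 1) ∈ algLift k 𝕜 := by
  -- The y-component of the lift is the common cofactor from `sum_comp`.
  refine ⟨C (k : Poly k 𝕜) * X * seqPoly k (fun s => c (k - j + 1 + s)) + C l, ?_, ?_⟩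
  · rw [compField, pullPoly_alpha_mkField hk _ _ _ _ (comp_last U_of_lt hc U_self hj w l hlc),
      neg_add_cancel, map_zero, zero_sub]
    exact sum_comp (pull k 𝕜) U_of_lt hc hc0 pull_U hpc (by omega) hw hl
  · rw [compField, pullPoly_beta_mkField hk, neg_add_cancel, map_zero, zero_sub]
    exact sum_comp (pull k 𝕜) (fun i hi => V_of_le i hk hi.le) hc hc0 pull_V hpc
      (by omega) hw hl

lemma field₂_mem_algLift (hk : 2 ≤ k) {j : ℕ} (hj : j < k) : field₂ k 𝕜 j ∈ algLift k 𝕜 := by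
  rw [field₂_eq hj]
  refine compField_mem_algLift hk U_of_lt (U_zero hk) pull_U pull_W₁ (by simp) hj ?_
  rw [U_self, Nat.cast_sub hj.le]
  ring

lemma field₃_mem_algLift (hk : 2 ≤ k) {j : ℕ} (hj : j < k) : field₃ k 𝕜 j ∈ algLift k 𝕜 := by
  rw [field₃_eq hj]
  refine compField_mem_algLift hk (fun i hi => V_of_le i hk hi.le) V_zero pull_V pull_W₂
    (by simp) hj ?_
  rw [V_of_le k hk le_rfl]
  ring

end Fields

/-! ### The Euler field and first family; removing W₁ and W₂ from `alpha`. -/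

section Generation

variable {k : ℕ} {𝕜 : Type*} [RCLike 𝕜]

lemma eulerField_mem_algLift (hk : 2 ≤ k) : eulerField k 𝕜 ∈ algLift k 𝕜 := by
  refine ⟨X, ?_, ?_⟩
  · rw [eulerField, pullPoly_alpha_mkField hk _ _ _ _ (by rw [U_pred hk, mul_zero]), polyU,
      ← euler_seqPoly U_of_lt, U_zero hk]
    simp [polyU]
  · rw [eulerField, pullPoly_beta_mkField hk, polyV,
      ← euler_seqPoly (fun i hi => V_of_le i hk hi.le), V_zero]
    simp [polyV]

lemma alpha_field₁ (j : ℕ) :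
    alpha k 𝕜 (field₁ k 𝕜 j) = (((k : Poly k 𝕜) - j) * U k 𝕜 j) • alpha k 𝕜 (eulerField k 𝕜) := by
  ext1 n
  rw [coeff_smul, field₁, eulerField, coeff_alpha_mkField, coeff_alpha_mkField, smul_eq_mul]
  split_ifs
  · ring
  · ring
  · ring

lemma field₁_eq (j : ℕ) : field₁ k 𝕜 j =
    mkField (k := k) (𝕜 := 𝕜) (fun i => ((k : Poly k 𝕜) - i) * (k - j) * U k 𝕜 i * U k 𝕜 j)
      (swapComp k (U k 𝕜) (V k 𝕜) (W₁ k 𝕜) (W₂ k 𝕜) (((k : Poly k 𝕜) - j) * U k 𝕜 j) j)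
      (k * ((k : Poly k 𝕜) - j) * U k 𝕜 j * W₁ k 𝕜)
      (-k * V k 𝕜 j * W₁ k 𝕜 + ((k : Poly k 𝕜) - j) * U k 𝕜 j * W₂ k 𝕜) := by
  refine mkField_congr (fun _ => rfl) (fun i => ?_) rfl rfl
  rw [swapComp]
  ring

lemma field₁_mem_algLift (hk : 2 ≤ k) {j : ℕ} (hj : 1 ≤ j) : field₁ k 𝕜 j ∈ algLift k 𝕜 := by
  refine ⟨C (((k : Poly k 𝕜) - j) * U k 𝕜 j) * X, ?_, ?_⟩
  · have h := euler_seqPoly (k := k) (a := U k 𝕜) U_of_lt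
    rw [alpha_field₁, pullPoly_smul, eulerField, pullPoly_alpha_mkField hk _ _ _ _
      (by rw [U_pred hk, mul_zero]), polyU, mul_left_comm, ← h, U_zero hk]
    simp [polyU]
  · rw [field₁_eq, pullPoly_beta_mkField hk]
    exact sum_swapComp (pull k 𝕜) U_of_lt (fun i hi => V_of_le i hk hi) (U_zero hk) V_zero
      pull_U pull_V hj pull_W₁ pull_W₂ (by simp)

variable (k 𝕜) in
/-- The module generated by the Euler field and the three families. -/
def genSpan : Submodule (Poly k 𝕜) (PolyField k 𝕜) :=
  Submodule.span _ (insert (eulerField k 𝕜)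
    {ζ | ∃ (i : Fin 3) (j : ℕ), j ∈ Finset.Icc 1 (k - 1) ∧ ζ = family k 𝕜 i j})

lemma eulerField_mem_genSpan : eulerField k 𝕜 ∈ genSpan k 𝕜 :=
  Submodule.subset_span (Set.mem_insert _ _)

lemma family_mem_genSpan (i : Fin 3) {j : ℕ} (hj : 1 ≤ j) (hjk : j < k) :
    family k 𝕜 i j ∈ genSpan k 𝕜 :=
  Submodule.subset_span (Set.mem_insert_of_mem _
    ⟨i, j, Finset.mem_Icc.2 ⟨hj, by omega⟩, rfl⟩)

lemma genSpan_le_algLift (hk : 2 ≤ k) : genSpan k 𝕜 ≤ algLift k 𝕜 := by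
  refine Submodule.span_le.2 (Set.insert_subset (eulerField_mem_algLift hk) ?_)
  rintro _ ⟨i, j, hj, rfl⟩
  rw [Finset.mem_Icc] at hj
  fin_cases i
  · exact field₁_mem_algLift hk hj.1
  · exact field₂_mem_algLift hk (by omega)
  · exact field₃_mem_algLift hk (by omega)

lemma exists_eq_of_mem_genSpan {ξ : PolyField k 𝕜} (hξ : ξ ∈ genSpan k 𝕜) :
    ∃ (gₑ : Poly k 𝕜) (g : Fin 3 → ℕ → Poly k 𝕜), ξ = gₑ • eulerField k 𝕜 +
      ∑ i : Fin 3, ∑ j ∈ Finset.Icc 1 (k - 1), g i j • family k 𝕜 i j := by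
  induction hξ using Submodule.span_induction with
  | mem x hx =>
    rcases hx with rfl | ⟨i, j, hj, rfl⟩
    · exact ⟨1, 0, by simp⟩
    · refine ⟨0, fun i' j' => if i' = i ∧ j' = j then 1 else 0, ?_⟩
      rw [zero_smul, zero_add, Finset.sum_eq_single i, Finset.sum_eq_single j]
      · simp
      · intro j' _ h
        simp [h]
      · exact fun h => absurd hj h
      · intro i' _ h
        simp [h]
      · simp
  | zero => exact ⟨0, 0, by simp⟩
  | add x y _ _ hx hy =>
    obtain ⟨a, g, rfl⟩ := hx
    obtain ⟨b, g', rfl⟩ := hy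
    refine ⟨a + b, g + g', ?_⟩
    simp only [Pi.add_apply, add_smul, Finset.sum_add_distrib]
    abel
  | smul s x _ hx =>
    obtain ⟨a, g, rfl⟩ := hx
    refine ⟨s * a, s • g, ?_⟩
    simp only [Pi.smul_apply, smul_eq_mul, mul_smul, smul_add, Finset.smul_sum]

variable (k 𝕜) in
/-- The polynomials in the coordinates `U_i` and `V_i`. -/
def baseAlg : Subalgebra 𝕜 (Poly k 𝕜) := AlgHom.equalizer (pull k 𝕜) CAlgHom

lemma mem_baseAlg {s : Poly k 𝕜} : s ∈ baseAlg k 𝕜 ↔ pull k 𝕜 s = C s := Iff.rfl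

lemma U_mem (r : ℕ) : U k 𝕜 r ∈ baseAlg k 𝕜 := pull_U r

lemma V_mem (r : ℕ) : V k 𝕜 r ∈ baseAlg k 𝕜 := pull_V r

variable (k 𝕜) in
/-- The polynomials in the coordinates `U_i`, `V_i` and `W₁`. -/
def baseAlgW₁ : Subalgebra 𝕜 (Poly k 𝕜) := Algebra.adjoin 𝕜 (insert (W₁ k 𝕜) (baseAlg k 𝕜 : Set _))

lemma baseAlg_le : baseAlg k 𝕜 ≤ baseAlgW₁ k 𝕜 :=
  fun _ h => Algebra.subset_adjoin (Set.mem_insert_of_mem _ h)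

lemma W₁_mem : W₁ k 𝕜 ∈ baseAlgW₁ k 𝕜 := Algebra.subset_adjoin (Set.mem_insert _ _)

lemma X_mem_baseAlg_or (t : Tgt k) : (MvPolynomial.X t : Poly k 𝕜) ∈ baseAlg k 𝕜 ∨
    MvPolynomial.X t = W₁ k 𝕜 ∨ MvPolynomial.X t = W₂ k 𝕜 := by
  rcases t with i | i | i
  · left
    rw [mem_baseAlg]
    simp [pull]
  · left
    rw [mem_baseAlg]
    simp [pull]
  · right
    fin_cases i
    · exact Or.inl rfl
    · exact Or.inr rfl

lemma adjoin_baseAlg : Algebra.adjoin 𝕜 ((baseAlg k 𝕜 : Set (Poly k 𝕜)) ∪ {W₁ k 𝕜, W₂ k 𝕜}) = ⊤ := by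
  rw [eq_top_iff, ← MvPolynomial.adjoin_range_X]
  refine Algebra.adjoin_mono ?_
  rintro _ ⟨t, rfl⟩
  rcases X_mem_baseAlg_or (𝕜 := 𝕜) t with h | h | h
  · exact Or.inl h
  · exact Or.inr (Or.inl h)
  · exact Or.inr (Or.inr h)

lemma adjoin_baseAlgW₁ : Algebra.adjoin 𝕜 ((baseAlgW₁ k 𝕜 : Set (Poly k 𝕜)) ∪ {W₂ k 𝕜}) = ⊤ := by
  rw [eq_top_iff, ← MvPolynomial.adjoin_range_X]
  refine Algebra.adjoin_mono ?_
  rintro _ ⟨t, rfl⟩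
  rcases X_mem_baseAlg_or (𝕜 := 𝕜) t with h | h | h
  · exact Or.inl (baseAlg_le h)
  · exact Or.inl (h ▸ W₁_mem)
  · exact Or.inr h

/-- Here w occurs in the coefficient at X^i only with factor k(k−d+i)U_{k−d+i}. This is zero for i >
d and equals k² for i = d because U_k = 1: the triangular system required by
`exists_sub_mem_coeffsIn`. -/
lemma compField_reduction {c : ℕ → Poly k 𝕜} (hc : ∀ i, c i ∈ baseAlg k 𝕜)
    {l : Poly k 𝕜} (hl : l ∈ baseAlg k 𝕜) (w : Poly k 𝕜) {d : ℕ} (hd : d < k - 1) :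
    ∃ H ∈ coeffsIn (baseAlg k 𝕜) (d + 1), ∃ b : 𝕜, b ≠ 0 ∧
      H.coeff d = algebraMap 𝕜 (Poly k 𝕜) b ∧
      alpha k 𝕜 (compField c w l (k - d)) - w • H ∈ coeffsIn (baseAlg k 𝕜) (k - 1) := by
  have hU : ∀ i, d < i → (k : Poly k 𝕜) * ((k - d + i : ℕ) : Poly k 𝕜) * U k 𝕜 (k - d + i) = 0 :=
    fun i hi => by rw [U_of_lt _ (by omega), mul_zero]
  have hw : ∀ (a : ℕ → Poly k 𝕜) (_ : ∀ i, a i ∈ baseAlg k 𝕜) (n i : ℕ),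
      ∑ r ∈ Finset.Icc 1 i, wedge (fun s => s * a s) c n r ∈ baseAlg k 𝕜 := fun a ha n i =>
    sum_mem fun r _ => sub_mem (mul_mem (mul_mem (natCast_mem _ _) (ha _)) (hc _))
      (mul_mem (mul_mem (natCast_mem _ _) (ha _)) (hc _))
  have hcomp : ∀ i, -comp k (U k 𝕜) c w l (k - d) i - w * ((k : Poly k 𝕜) *
      ((k - d + i : ℕ) : Poly k 𝕜) * U k 𝕜 (k - d + i)) ∈ baseAlg k 𝕜 := by
    intro i
    have h : -comp k (U k 𝕜) c w l (k - d) i - w * ((k : Poly k 𝕜) *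
        ((k - d + i : ℕ) : Poly k 𝕜) * U k 𝕜 (k - d + i)) = l * ((i : Poly k 𝕜) + 1) *
        U k 𝕜 (i + 1) - k * ∑ r ∈ Finset.Icc 1 i,
          wedge (fun s => s * U k 𝕜 s) c (k - d + i) r := by
      rw [comp]
      ring
    rw [h]
    exact sub_mem (mul_mem (mul_mem hl (add_mem (natCast_mem _ _) (one_mem _))) (U_mem _))
      (mul_mem (natCast_mem _ _) (hw _ U_mem _ _))
  refine ⟨seqPoly d fun i => k * ((k - d + i : ℕ) : Poly k 𝕜) * U k 𝕜 (k - d + i), fun i => ?_,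
    k * k, ?_, ?_, fun i => ?_⟩
  · rw [coeff_seqPoly hU]
    exact ⟨mul_mem (mul_mem (natCast_mem _ _) (natCast_mem _ _)) (U_mem _), fun h => hU i h⟩
  · have : (k : 𝕜) ≠ 0 := Nat.cast_ne_zero.2 (by omega)
    exact mul_ne_zero this this
  · rw [coeff_seqPoly hU, Nat.sub_add_cancel (by omega), U_self]
    simp
  · rw [coeff_sub, coeff_smul, coeff_seqPoly hU, compField, coeff_alpha_mkField, smul_eq_mul]
    split_ifs with h₀ h₁
    · exact ⟨h₀ ▸ hcomp i, fun h => by omega⟩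
    · exact ⟨hcomp i, fun h => by omega⟩
    · rw [hU i (by omega)]
      simp

lemma exists_alpha_sub_mem (hk : 2 ≤ k) (ξ : PolyField k 𝕜) :
    ∃ ζ ∈ genSpan k 𝕜, alpha k 𝕜 (ξ - ζ) ∈ coeffsIn (baseAlg k 𝕜) (k - 1) := by
  have key : ∃ ζ ∈ (genSpan k 𝕜).map (alpha k 𝕜),
      alpha k 𝕜 ξ - ζ ∈ coeffsIn (baseAlg k 𝕜) (k - 1) := by
    refine exists_sub_mem_coeffsIn (baseAlg k 𝕜) _ adjoin_baseAlg (k - 1) _ ?_ ?_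
    · intro w hw d hd
      -- The member j = d + 1 of a family handles degree d; the second family removes W₁, the third
      -- W₂.
      have hkd : k - (d + 1) + 1 = k - d := by omega
      rcases hw with rfl | rfl
      · obtain ⟨H, hH, b, hb, hHb, h⟩ := compField_reduction (c := U k 𝕜)
          (l := (d + 1 : ℕ) * U k 𝕜 (k - (d + 1))) U_mem
          (mul_mem (natCast_mem _ _) (U_mem _)) (W₁ k 𝕜) hd
        refine ⟨H, hH, b, hb, hHb, _, ⟨_, family_mem_genSpan 1 (j := d + 1) (by omega) (by omega),
          rfl⟩, ?_⟩
        rw [← hkd, ← field₂_eq (by omega)] at h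
        exact h
      · obtain ⟨H, hH, b, hb, hHb, h⟩ := compField_reduction (c := V k 𝕜)
          (l := k * V k 𝕜 (k - (d + 1))) V_mem (mul_mem (natCast_mem _ _) (V_mem _)) (W₂ k 𝕜) hd
        refine ⟨H, hH, b, hb, hHb, _, ⟨_, family_mem_genSpan 2 (j := d + 1) (by omega) (by omega),
          rfl⟩, ?_⟩
        rw [← hkd, ← field₃_eq (by omega)] at h
        exact h
    · intro i hi
      rw [coeff_alpha, if_neg (by omega), dif_neg (by omega)]
  obtain ⟨_, ⟨ζ, hζ, rfl⟩, h⟩ := key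
  exact ⟨ζ, hζ, by rwa [map_sub]⟩

end Generation

/-! ### Removing W₂ from `beta` by generators with vanishing `alpha`. -/

section SecondReduction

variable {k : ℕ} {𝕜 : Type*} [RCLike 𝕜]

lemma sum_wedge_add {S : Type*} [CommRing S] {a c : ℕ → S} (ha : ∀ i, k < i → a i = 0)
    (hc : ∀ i, k < i → c i = 0) {n : ℕ} (hn : 1 ≤ n) :
    ∑ r ∈ Finset.Icc 1 n, wedge a c (k + n) r = a k * c n - a n * c k := by
  rw [Finset.sum_eq_single n, wedge, Nat.add_sub_cancel]
  · intro r hr h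
    rw [Finset.mem_Icc] at hr
    rw [wedge, ha (k + n - r) (by omega), hc (k + n - r) (by omega)]
    ring
  · intro h
    exact absurd (Finset.mem_Icc.2 ⟨hn, le_rfl⟩) h

lemma comp_mem {S : Type*} [CommRing S] [Algebra 𝕜 S] {T : Subalgebra 𝕜 S} {a c : ℕ → S} {w l : S}
    (ha : ∀ i, a i ∈ T) (hc : ∀ i, c i ∈ T) (hw : w ∈ T) (hl : l ∈ T) (m i : ℕ) :
    comp k a c w l m i ∈ T := by
  refine sub_mem (add_mem (mul_mem (mul_mem (mul_mem (neg_mem (natCast_mem _ _)) (natCast_mem _ _))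
    (ha _)) hw) (mul_mem (natCast_mem _ _) (sum_mem fun r _ => ?_)))
    (mul_mem (mul_mem hl (add_mem (natCast_mem _ _) (one_mem _))) (ha _))
  exact sub_mem (mul_mem (mul_mem (natCast_mem _ _) (ha _)) (hc _))
    (mul_mem (mul_mem (natCast_mem _ _) (ha _)) (hc _))

/-- For j = 1 the shift is k, so only the term r = i of the sum survives, and the factor l is a
multiple of U_{k-1} = 0. -/
lemma alpha_field₂_one (hk : 2 ≤ k) :
    alpha k 𝕜 (field₂ k 𝕜 1) = (k : Poly k 𝕜) • alpha k 𝕜 (eulerField k 𝕜) := by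
  ext1 n
  have hk1 : k - 1 + 1 = k := by omega
  rw [field₂_eq (by omega), compField, eulerField, coeff_smul, coeff_alpha_mkField,
    coeff_alpha_mkField, U_pred hk, mul_zero, hk1, smul_eq_mul]
  split_ifs with h₀ h₁
  · rw [comp]
    simp only [add_zero, U_self, Finset.Icc_eq_empty_of_lt Nat.zero_lt_one, Finset.sum_empty]
    ring
  · rw [comp, sum_wedge_add (fun i hi => by rw [U_of_lt i hi, mul_zero]) U_of_lt (by omega), U_self,
      U_of_lt (k + n) (by omega)]
    ring
  · rw [mul_zero]

/-- This is the degree 0 step. The first family would need j = k for it; instead, W₂ enters this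
combination only through C₂ of the Euler field. -/
lemma second_euler_reduction (hk : 2 ≤ k) :
    beta k 𝕜 ((k : Poly k 𝕜) • eulerField k 𝕜 - field₂ k 𝕜 1) -
      W₂ k 𝕜 • C ((k : Poly k 𝕜) * k) ∈ coeffsIn (baseAlgW₁ k 𝕜) k := by
  have hcomp : ∀ i, comp k (V k 𝕜) (U k 𝕜) (W₁ k 𝕜) ((1 : ℕ) * U k 𝕜 (k - 1)) (k - 1 + 1) i ∈
      baseAlgW₁ k 𝕜 :=
    comp_mem (fun i => baseAlg_le (V_mem i)) (fun i => baseAlg_le (U_mem i)) W₁_mem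
      (mul_mem (natCast_mem _ _) (baseAlg_le (U_mem _))) _
  intro n
  rw [field₂_eq (by omega), compField, eulerField, map_sub, map_smul, coeff_sub, coeff_sub,
    coeff_smul, coeff_smul, coeff_beta_mkField, coeff_beta_mkField, coeff_C, smul_eq_mul,
    smul_eq_mul]
  refine ⟨?_, fun h => ?_⟩
  · split_ifs with h₀ h₁
    · convert hcomp 0 using 1
      ring
    · rw [mul_zero, sub_zero]
      exact sub_mem (mul_mem (natCast_mem _ _) (neg_mem (mul_mem
        (sub_mem (natCast_mem _ _) (natCast_mem _ _)) (baseAlg_le (V_mem _))))) (neg_mem (hcomp _))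
    · simp
  · rw [if_neg (by omega), if_neg (by omega), if_neg (by omega), if_neg (by omega),
      if_neg (by omega)]
    ring

/-- Subtracting the multiple of the Euler field kills `alpha` (`alpha_field₁`). What multiplies W₂
at X^i, i ≥ 1, is kU_{k−d+i}, which ends at i = d with U_k = 1. -/
lemma field₁_reduction {d : ℕ} (hd : 1 ≤ d) (hdk : d < k) :
    ∃ H ∈ coeffsIn (baseAlgW₁ k 𝕜) (d + 1), H.coeff d = algebraMap 𝕜 (Poly k 𝕜) k ∧
      beta k 𝕜 (field₁ k 𝕜 (k - d) -
        (((k : Poly k 𝕜) - (k - d : ℕ)) * U k 𝕜 (k - d)) • eulerField k 𝕜) -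
        W₂ k 𝕜 • H ∈ coeffsIn (baseAlgW₁ k 𝕜) k := by
  set j := k - d with hj
  set s : Poly k 𝕜 := ((k : Poly k 𝕜) - j) * U k 𝕜 j with hs
  have hU : ∀ i, U k 𝕜 i ∈ baseAlgW₁ k 𝕜 := fun i => baseAlg_le (U_mem i)
  have hV : ∀ i, V k 𝕜 i ∈ baseAlgW₁ k 𝕜 := fun i => baseAlg_le (V_mem i)
  have hn : ∀ n : ℕ, (n : Poly k 𝕜) ∈ baseAlgW₁ k 𝕜 := natCast_mem _
  have hsm : s ∈ baseAlgW₁ k 𝕜 := mul_mem (sub_mem (hn _) (hn _)) (hU _)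
  -- The value at 0 comes from the W₂ terms of the two C₂ components: s from the first family, sk
  -- from the multiple of the Euler field.
  set H : ℕ → Poly k 𝕜 := fun i => if i = 0 then s - s * k else k * U k 𝕜 (j + i) with hH
  have hH0 : ∀ i, d < i → H i = 0 := fun i hi => by
    rw [hH]
    simp only
    rw [if_neg (by omega), U_of_lt _ (by omega), mul_zero]
  have hHm : ∀ i, H i ∈ baseAlgW₁ k 𝕜 := fun i => by
    rw [hH]
    simp only
    split_ifs
    · exact sub_mem hsm (mul_mem hsm (hn _))
    · exact mul_mem (hn _) (hU _)
  refine ⟨seqPoly d H, fun i => ?_, ?_, fun i => ?_⟩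
  · rw [coeff_seqPoly hH0]
    exact ⟨hHm i, fun h => hH0 i h⟩
  · rw [coeff_seqPoly hH0, hH]
    simp only
    rw [if_neg (by omega), show j + d = k by omega, U_self]
    simp
  · rw [field₁_eq, eulerField, map_sub, map_smul, coeff_sub, coeff_sub, coeff_smul, coeff_smul,
      coeff_beta_mkField, coeff_beta_mkField, coeff_seqPoly hH0, smul_eq_mul, smul_eq_mul]
    refine ⟨?_, fun h => ?_⟩
    · split_ifs with h₀ h₁
      · have h : -k * V k 𝕜 j * W₁ k 𝕜 + s * W₂ k 𝕜 - s * (k * W₂ k 𝕜) - W₂ k 𝕜 * H i =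
            -k * V k 𝕜 j * W₁ k 𝕜 := by
          rw [hH]
          simp only
          rw [if_pos h₀]
          ring
        rw [h]
        exact mul_mem (mul_mem (neg_mem (hn _)) (hV _)) W₁_mem
      · have h : -swapComp k (U k 𝕜) (V k 𝕜) (W₁ k 𝕜) (W₂ k 𝕜) s j i -
            s * -((k - i) * V k 𝕜 i) - W₂ k 𝕜 * H i =
            -(k * ∑ r ∈ Finset.Icc 1 i, wedge (U k 𝕜) (V k 𝕜) (j + i) r
              - k * U k 𝕜 j * V k 𝕜 i - ((i : Poly k 𝕜) - 1) * s * V k 𝕜 i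
              + k * V k 𝕜 (j + i) * W₁ k 𝕜) + s * ((k - i) * V k 𝕜 i) := by
          rw [hH, swapComp_eq V_zero]
          simp only
          rw [if_neg h₀]
          ring
        rw [h]
        refine add_mem (neg_mem (add_mem (sub_mem (sub_mem (mul_mem (hn _) (sum_mem fun r _ =>
          sub_mem (mul_mem (hU _) (hV _)) (mul_mem (hU _) (hV _))))
          (mul_mem (mul_mem (hn _) (hU _)) (hV _)))
          (mul_mem (mul_mem (sub_mem (hn _) (one_mem _)) hsm) (hV _)))
          (mul_mem (mul_mem (hn _) (hV _)) W₁_mem)))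
          (mul_mem hsm (mul_mem (sub_mem (hn _) (hn _)) (hV _)))
      · rw [hH0 i (by omega)]
        simp
    · rw [if_neg (by omega), if_neg (by omega), if_neg (by omega), if_neg (by omega),
        hH0 i (by omega)]
      ring

lemma exists_beta_sub_mem (hk : 2 ≤ k) (ξ : PolyField k 𝕜) :
    ∃ ζ ∈ genSpan k 𝕜, alpha k 𝕜 ζ = 0 ∧
      beta k 𝕜 (ξ - ζ) ∈ coeffsIn (baseAlgW₁ k 𝕜) k := by
  have hk0 : (k : 𝕜) ≠ 0 := Nat.cast_ne_zero.2 (by omega)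
  have key : ∃ ζ ∈ (genSpan k 𝕜 ⊓ LinearMap.ker (alpha k 𝕜)).map (beta k 𝕜),
      beta k 𝕜 ξ - ζ ∈ coeffsIn (baseAlgW₁ k 𝕜) k := by
    refine exists_sub_mem_coeffsIn (baseAlgW₁ k 𝕜) _ adjoin_baseAlgW₁ k _ ?_ ?_
    · intro w hw d hd
      obtain rfl : w = W₂ k 𝕜 := hw
      rcases Nat.eq_zero_or_pos d with rfl | hd'
      · refine ⟨C ((k : Poly k 𝕜) * k), fun i => ?_, k * k, mul_ne_zero hk0 hk0, by simp, _,
          ⟨_, ⟨sub_mem (Submodule.smul_mem _ _ eulerField_mem_genSpan)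
            (family_mem_genSpan 1 (j := 1) le_rfl (by omega)), ?_⟩, rfl⟩, second_euler_reduction hk⟩
        · rw [coeff_C]
          refine ⟨?_, fun h => if_neg (by omega)⟩
          split_ifs
          · exact mul_mem (natCast_mem _ _) (natCast_mem _ _)
          · exact zero_mem _
        · change alpha k 𝕜 (_ - field₂ k 𝕜 1) = 0
          rw [map_sub, map_smul, alpha_field₂_one hk, sub_self]
      · obtain ⟨H, hH, hHd, h⟩ := field₁_reduction (𝕜 := 𝕜) hd' hd
        refine ⟨H, hH, k, hk0, hHd, _, ⟨_, ⟨sub_mem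
          (family_mem_genSpan 0 (j := k - d) (by omega) (by omega))
          (Submodule.smul_mem _ _ eulerField_mem_genSpan), ?_⟩, rfl⟩, h⟩
        change alpha k 𝕜 (field₁ k 𝕜 (k - d) - _) = 0
        rw [map_sub, map_smul, alpha_field₁, sub_self]
    · intro i hi
      rw [coeff_beta, if_neg (by omega), dif_neg (by omega)]
  obtain ⟨_, ⟨ζ, ⟨hζ, hζ'⟩, rfl⟩, h⟩ := key
  exact ⟨ζ, hζ, hζ', by rwa [map_sub]⟩

end SecondReduction

/-! ### A reduced field with a polynomial lift is zero. -/

section Uniqueness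

variable {k : ℕ} {𝕜 : Type*} [RCLike 𝕜]

lemma coeff_polyU (n : ℕ) : (polyU k 𝕜).coeff n = U k 𝕜 n := coeff_seqPoly U_of_lt n

lemma natDegree_polyU : (polyU k 𝕜).natDegree = k := by
  refine le_antisymm (natDegree_le_iff_coeff_eq_zero.2 fun n hn => ?_)
    (le_natDegree_of_ne_zero ?_)
  · rw [coeff_polyU, U_of_lt n hn]
  · rw [coeff_polyU, U_self]
    exact one_ne_zero

lemma coeff_derivative_polyU (hk : 2 ≤ k) : (derivative (polyU k 𝕜)).coeff (k - 1) = k := by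
  have h : k - 1 + 1 = k := by omega
  rw [coeff_derivative, coeff_polyU, h, U_self, one_mul, ← Nat.cast_succ, Nat.succ_eq_add_one, h]

lemma derivative_polyU_ne_zero (hk : 2 ≤ k) : derivative (polyU k 𝕜) ≠ 0 := by
  intro h
  have := coeff_derivative_polyU (𝕜 := 𝕜) hk
  rw [h, coeff_zero] at this
  exact Nat.cast_ne_zero.2 (by omega) this.symm

lemma le_natDegree_derivative_polyU (hk : 2 ≤ k) : k - 1 ≤ (derivative (polyU k 𝕜)).natDegree := by
  refine le_natDegree_of_ne_zero ?_
  rw [coeff_derivative_polyU hk]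
  exact Nat.cast_ne_zero.2 (by omega)

lemma pullPoly_of_mem_coeffsIn {n : ℕ} {f : (Poly k 𝕜)[X]} (hf : f ∈ coeffsIn (baseAlg k 𝕜) n) :
    pullPoly k 𝕜 f = f := by
  have h := eq_sum_of_coeff_eq_zero fun i hi => (hf i).2 hi
  conv_lhs => rw [h]
  conv_rhs => rw [h]
  rw [map_sum]
  refine Finset.sum_congr rfl fun i _ => ?_
  rw [pullPoly_smul, map_pow, pullPoly_X, mem_baseAlg.1 (hf i).1, smul_eq_C_mul]

lemma eq_zero_of_derivative_dvd (hk : 2 ≤ k) {f h : (Poly k 𝕜)[X]}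
    (hf : f ∈ coeffsIn (baseAlg k 𝕜) (k - 1)) (hfh : f = derivative (polyU k 𝕜) * h) : h = 0 := by
  by_contra hh
  have h₁ : f.natDegree < k - 1 := by
    rcases Nat.lt_or_ge f.natDegree (k - 1) with h' | h'
    · exact h'
    · refine absurd ((hf f.natDegree).2 h') (leadingCoeff_ne_zero.2 ?_)
      rw [hfh]
      exact mul_ne_zero (derivative_polyU_ne_zero hk) hh
  rw [hfh, natDegree_mul (derivative_polyU_ne_zero hk) hh] at h₁
  have := le_natDegree_derivative_polyU (𝕜 := 𝕜) hk
  omega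

lemma exists_aeval_of_mem_baseAlgW₁ {s : Poly k 𝕜} (hs : s ∈ baseAlgW₁ k 𝕜) :
    ∃ q : (baseAlg k 𝕜)[X], s = aeval (W₁ k 𝕜) q := by
  induction hs using Algebra.adjoin_induction with
  | mem x hx =>
    rcases hx with rfl | hx
    · exact ⟨X, by simp⟩
    · exact ⟨C ⟨x, hx⟩, by rw [aeval_C]; rfl⟩
  | algebraMap r => exact ⟨C (algebraMap 𝕜 _ r), by rw [aeval_C]; rfl⟩
  | add x y _ _ hx hy =>
    obtain ⟨p, rfl⟩ := hx
    obtain ⟨q, rfl⟩ := hy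
    exact ⟨p + q, by rw [map_add]⟩
  | mul x y _ _ hx hy =>
    obtain ⟨p, rfl⟩ := hx
    obtain ⟨q, rfl⟩ := hy
    exact ⟨p * q, by rw [map_mul]⟩

lemma pull_aeval (q : (baseAlg k 𝕜)[X]) : pull k 𝕜 (aeval (W₁ k 𝕜) q) =
    (q.map (algebraMap (baseAlg k 𝕜) (Poly k 𝕜))).comp (polyU k 𝕜) := by
  induction q using Polynomial.induction_on' with
  | add p q hp hq => rw [map_add, map_add, hp, hq, Polynomial.map_add, add_comp]
  | monomial n a =>
    rw [aeval_monomial, map_monomial, monomial_comp, map_mul, map_pow, pull_W₁]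
    congr 1
    exact mem_baseAlg.1 a.2

/-- Such an element is q(W₁) and pulls back to the composite q ∘ P, where P has degree k. -/
lemma pull_of_mem_baseAlgW₁ (hk : 2 ≤ k) {s : Poly k 𝕜} (hs : s ∈ baseAlgW₁ k 𝕜) :
    k ∣ (pull k 𝕜 s).natDegree ∧ (pull k 𝕜 s = 0 → s = 0) := by
  obtain ⟨q, rfl⟩ := exists_aeval_of_mem_baseAlgW₁ hs
  rw [pull_aeval, natDegree_comp, natDegree_polyU]
  refine ⟨dvd_mul_left _ _, fun h => ?_⟩
  rcases comp_eq_zero_iff.1 h with h | ⟨-, h⟩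
  · rw [Polynomial.map_eq_zero_iff Subtype.val_injective] at h
    rw [h, map_zero]
  · have := natDegree_polyU (k := k) (𝕜 := 𝕜)
    rw [h, natDegree_C] at this
    omega

lemma eq_zero_of_pullPoly_eq_zero (hk : 2 ≤ k) {f : (Poly k 𝕜)[X]}
    (hf : f ∈ coeffsIn (baseAlgW₁ k 𝕜) k) (h : pullPoly k 𝕜 f = 0) : f = 0 := by
  rw [eq_sum_of_coeff_eq_zero fun i hi => (hf i).2 hi, map_sum] at h
  simp only [pullPoly_smul, map_pow, pullPoly_X] at h
  -- The nonzero summands have degrees in distinct classes modulo k, so they cannot cancel.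
  have hdeg := degree_sum_eq_of_disjoint (fun i => pull k 𝕜 (f.coeff i) * X ^ i) (Finset.range k) ?_
  · rw [h, degree_zero, eq_comm, Finset.sup_eq_bot_iff] at hdeg
    ext1 i
    rw [coeff_zero]
    rcases Nat.lt_or_ge i k with hi | hi
    · have h₁ := degree_eq_bot.1 (hdeg i (Finset.mem_range.2 hi))
      rw [mul_eq_zero, or_iff_left (pow_ne_zero _ X_ne_zero)] at h₁
      exact (pull_of_mem_baseAlgW₁ hk (hf i).1).2 h₁
    · exact (hf i).2 hi
  · rintro i ⟨hi, hi0⟩ j ⟨hj, hj0⟩ hij heq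
    rw [Finset.mem_range] at hi hj
    simp only [Function.comp] at heq
    have h₁ := natDegree_eq_of_degree_eq heq
    rw [natDegree_mul (left_ne_zero_of_mul hi0) (right_ne_zero_of_mul hi0),
      natDegree_mul (left_ne_zero_of_mul hj0) (right_ne_zero_of_mul hj0), natDegree_X_pow,
      natDegree_X_pow] at h₁
    obtain ⟨a, ha⟩ := (pull_of_mem_baseAlgW₁ hk (hf i).1).1
    obtain ⟨b, hb⟩ := (pull_of_mem_baseAlgW₁ hk (hf j).1).1
    rw [ha, hb] at h₁
    have h₂ := congrArg (· % k) h₁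
    simp only [Nat.mul_add_mod, Nat.mod_eq_of_lt hi, Nat.mod_eq_of_lt hj] at h₂
    exact hij h₂

/-- Polynomial vector fields with a polynomial lift are generated by the Euler field and the three
families. -/
theorem algLift_le_genSpan (hk : 2 ≤ k) : algLift k 𝕜 ≤ genSpan k 𝕜 := by
  intro ξ hξ
  obtain ⟨ζ, hζ, hα⟩ := exists_alpha_sub_mem hk ξ
  obtain ⟨ζ', hζ', hαζ', hβ⟩ := exists_beta_sub_mem hk (ξ - ζ)
  obtain ⟨h, h₁, h₂⟩ := sub_mem (sub_mem hξ (genSpan_le_algLift hk hζ))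
    (genSpan_le_algLift hk hζ')
  have hα' : alpha k 𝕜 (ξ - ζ - ζ') ∈ coeffsIn (baseAlg k 𝕜) (k - 1) := by
    rwa [map_sub, hαζ', sub_zero]
  rw [pullPoly_of_mem_coeffsIn hα'] at h₁
  have h0 := eq_zero_of_derivative_dvd hk hα' h₁
  rw [h0, mul_zero] at h₁ h₂
  have := eq_zero_of_alpha_of_beta h₁ (eq_zero_of_pullPoly_eq_zero hk hβ h₂)
  rw [sub_sub, sub_eq_zero] at this
  rw [this]
  exact add_mem hζ hζ'

end Uniqueness

/-! ### From vanishing at points near the origin to polynomial divisibility. -/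

section Evaluation

variable {k : ℕ} {𝕜 : Type*} [RCLike 𝕜]

lemma polyU_eq (hk : 2 ≤ k) : polyU k 𝕜 =
    X ^ k + ∑ i : Fin (k - 2), C (MvPolynomial.X (.inl i)) * X ^ ((i : ℕ) + 1) := by
  ext1 n
  rw [coeff_polyU, coeff_add, coeff_X_pow, finsetSum_coeff]
  simp only [coeff_C_mul, coeff_X_pow]
  rw [U]
  split_ifs with h₁ h₂ h₂
  · omega
  · rw [Finset.sum_eq_single (⟨n - 1, by omega⟩ : Fin (k - 2)), if_pos (by simp only; omega)]
    · simp
    · intro b _ hb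
      rw [if_neg, mul_zero]
      rintro rfl
      exact hb (Fin.ext (by simp))
    · simp
  · rw [Finset.sum_eq_zero, add_zero]
    intro b _
    rw [if_neg (by omega), mul_zero]
  · rw [Finset.sum_eq_zero, add_zero]
    intro b _
    rw [if_neg (by omega), mul_zero]

lemma polyV_eq (hk : 2 ≤ k) : polyV k 𝕜 =
    ∑ i : Fin (k - 1), C (MvPolynomial.X (.inr (.inl i))) * X ^ ((i : ℕ) + 1) := by
  ext1 n
  rw [polyV, coeff_seqPoly fun i hi => V_of_le i hk hi.le, finsetSum_coeff]
  simp only [coeff_C_mul, coeff_X_pow]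
  rw [V]
  split_ifs with h₁
  · rw [Finset.sum_eq_single (⟨n - 1, by omega⟩ : Fin (k - 1)), if_pos (by simp only; omega)]
    · simp
    · intro b _ hb
      rw [if_neg, mul_zero]
      rintro rfl
      exact hb (Fin.ext (by simp))
    · simp
  · rw [Finset.sum_eq_zero]
    intro b _
    rw [if_neg (by omega), mul_zero]

/-- Evaluation at a point `p` of the target and a value `y` of the variable. -/
def ev (p : Tgt k → 𝕜) (y : 𝕜) : (Poly k 𝕜)[X] →+* 𝕜 := eval₂RingHom (MvPolynomial.eval p) y

@[simp] lemma ev_C (p : Tgt k → 𝕜) (y : 𝕜) (s : Poly k 𝕜) : ev p y (C s) = MvPolynomial.eval p s := by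
  simp [ev]

@[simp] lemma ev_X (p : Tgt k → 𝕜) (y : 𝕜) : ev p y X = y := by simp [ev]

/-- The point of the source with coordinates `u_i`, `v_i` taken from `p`, and `y`. -/
def src (p : Tgt k → 𝕜) (y : 𝕜) : Src k → 𝕜
  | .inl i => p (.inl i)
  | .inr (.inl i) => p (.inr (.inl i))
  | .inr (.inr ()) => y

lemma ev_pull (hk : 2 ≤ k) (p : Tgt k → 𝕜) (y : 𝕜) (s : Poly k 𝕜) :
    ev p y (pull k 𝕜 s) = MvPolynomial.eval (crossCap k 𝕜 (src p y)) s := by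
  induction s using MvPolynomial.induction_on with
  | C a =>
    rw [MvPolynomial.eval_C, ← MvPolynomial.algebraMap_eq, AlgHom.commutes,
      IsScalarTower.algebraMap_apply 𝕜 (Poly k 𝕜) (Poly k 𝕜)[X], Polynomial.algebraMap_eq, ev_C,
      MvPolynomial.algebraMap_eq, MvPolynomial.eval_C]
  | add s t hs ht => rw [map_add, map_add, map_add, hs, ht]
  | mul_X s t hs =>
    rw [map_mul, map_mul, map_mul, hs, MvPolynomial.eval_X]
    congr 1
    rcases t with i | i | i
    · simp [pull, crossCap, src]
    · simp [pull, crossCap, src]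
    · fin_cases i
      · simp [pull, crossCap, src, polyU_eq hk]
      · simp [pull, crossCap, src, polyV_eq hk]

lemma eq_zero_of_ev {g : (Poly k 𝕜)[X]} (h : ∀ p y, ev p y g = 0) : g = 0 := by
  refine eq_zero_of_infinite_isRoot g (Set.Infinite.mono (s := Set.range fun c : 𝕜 =>
    (MvPolynomial.C c : Poly k 𝕜)) ?_ (Set.infinite_range_of_injective
      (MvPolynomial.C_injective _ _)))
  rintro _ ⟨y, rfl⟩
  refine MvPolynomial.funext fun p => ?_
  rw [map_zero, ← h p y, ev, coe_eval₂RingHom, eval, hom_eval₂]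
  simp

lemma ev_derivative_polyU (hk : 2 ≤ k) (p : Tgt k → 𝕜) (y : 𝕜) :
    ev p y (derivative (polyU k 𝕜)) =
      k * y ^ (k - 1) + ∑ i : Fin (k - 2), p (.inl i) * (((i : ℕ) + 1) * y ^ (i : ℕ)) := by
  rw [polyU_eq hk]
  simp [derivative_X_pow]

lemma ev_derivative_polyV (hk : 2 ≤ k) (p : Tgt k → 𝕜) (y : 𝕜) :
    ev p y (derivative (polyV k 𝕜)) =
      ∑ i : Fin (k - 1), p (.inr (.inl i)) * (((i : ℕ) + 1) * y ^ (i : ℕ)) := by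
  rw [polyV_eq hk]
  simp

/-- A weight for which the derivative of `polyU` is homogeneous. -/
def weight : Tgt k → ℕ
  | .inl i => k - 1 - i
  | .inr _ => 1

/-- Positivity makes every dilation orbit tend to the origin as s → 0. Nothing more is asked of the
V and W coordinates, which do not occur in P'. -/
lemma weight_pos (t : Tgt k) : weight t ≠ 0 := by
  rcases t with i | i
  · simp only [weight]
    omega
  · simp [weight]

/-- The weighted dilation of the target by the factor `s`. -/
def dilate (s : 𝕜) (p : Tgt k → 𝕜) : Tgt k → 𝕜 := fun t => p t * s ^ weight t

lemma ev_dilate_derivative_polyU (hk : 2 ≤ k) (s : 𝕜) (p : Tgt k → 𝕜) (y : 𝕜) :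
    ev (dilate s p) (y * s) (derivative (polyU k 𝕜)) =
      s ^ (k - 1) * ev p y (derivative (polyU k 𝕜)) := by
  rw [ev_derivative_polyU hk, ev_derivative_polyU hk, mul_add, Finset.mul_sum]
  congr 1
  · ring
  · refine Finset.sum_congr rfl fun i _ => ?_
    rw [dilate, weight, show s ^ (k - 1) = s ^ (k - 1 - (i : ℕ)) * s ^ (i : ℕ) by
      rw [← pow_add]; congr 1; omega]
    ring

lemma exists_eval_eq_ev_dilate (p : Tgt k → 𝕜) (y : 𝕜) (g : (Poly k 𝕜)[X]) :
    ∃ r : 𝕜[X], ∀ s, r.eval s = ev (dilate s p) (y * s) g := by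
  refine ⟨g.eval₂ (MvPolynomial.eval₂Hom C fun t => C (p t) * X ^ weight t) (C y * X), fun s => ?_⟩
  rw [← coe_evalRingHom, hom_eval₂, ev, coe_eval₂RingHom]
  congr 1
  · refine MvPolynomial.ringHom_ext (fun a => ?_) fun t => ?_
    · simp
    · simp [dilate]
  · simp

/-- A polynomial vanishing near the origin along a dilation orbit vanishes on the orbit. -/
lemma ev_eq_zero_of_dilate {N : Set (Src k → 𝕜)} (hN : IsOpen N) (h0 : 0 ∈ N)
    (p : Tgt k → 𝕜) (y : 𝕜) (g : (Poly k 𝕜)[X])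
    (h : ∀ s, src (dilate s p) (y * s) ∈ N → ev (dilate s p) (y * s) g = 0) : ev p y g = 0 := by
  obtain ⟨r, hr⟩ := exists_eval_eq_ev_dilate p y g
  have hcont : Continuous fun s : 𝕜 => src (dilate s p) (y * s) := by
    refine continuous_pi fun t => ?_
    rcases t with i | i | i
    · simp only [src, dilate]
      fun_prop
    · simp only [src, dilate]
      fun_prop
    · simp only [src]
      fun_prop
  have hzero : src (dilate (0 : 𝕜) p) (y * 0) = 0 := by
    funext t
    rcases t with i | i | i
    · simp [src, dilate, weight_pos]
    · simp [src, dilate, weight_pos]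
    · simp [src]
  have hnhds : {s : 𝕜 | src (dilate s p) (y * s) ∈ N} ∈ nhds (0 : 𝕜) :=
    (hN.preimage hcont).mem_nhds (by rw [Set.mem_preimage, hzero]; exact h0)
  have hr0 : r = 0 := eq_zero_of_infinite_isRoot r
    ((infinite_of_mem_nhds (0 : 𝕜) hnhds).mono fun s hs => (hr s).trans (h s hs))
  have h1 := hr 1
  have hp : dilate 1 p = p := by
    funext t
    simp [dilate]
  rw [hr0, eval_zero, mul_one, hp] at h1
  exact h1.symm

/-- For k ≥ 3 the zero set of P' is a graph over the remaining variables, since P' is U_1 plus terms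
free of U_1. Vanishing on it therefore implies divisibility over ℝ as well as over ℂ. -/
lemma derivative_polyU_dvd (hk : 2 ≤ k) {f : (Poly k 𝕜)[X]}
    (h : ∀ p y, ev p y (derivative (polyU k 𝕜)) = 0 → ev p y f = 0) :
    derivative (polyU k 𝕜) ∣ f := by
  rcases Nat.eq_or_lt_of_le hk with rfl | hk3
  · have h₁ : derivative (polyU 2 𝕜) = C (MvPolynomial.C 2) * X := by
      rw [polyU_eq hk, map_ofNat, map_ofNat]
      simp [one_add_one_eq_two]
      exact map_ofNat C 2
    have h₂ : f.coeff 0 = 0 := by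
      refine MvPolynomial.funext fun p => ?_
      have h₃ := h p 0 (by rw [h₁]; simp)
      rw [map_zero, ← h₃, ev, coe_eval₂RingHom, eval₂_at_zero]
    obtain ⟨g, rfl⟩ := X_dvd_iff.2 h₂
    refine ⟨C (MvPolynomial.C 2⁻¹) * g, ?_⟩
    rw [h₁, mul_mul_mul_comm, ← map_mul, ← map_mul, mul_inv_cancel₀ two_ne_zero, map_one, map_one,
      one_mul]
  · have hi : 0 < k - 2 := by omega
    set D := derivative (polyU k 𝕜) with hD
    -- The substitution U_1 ↦ U_1 − P' is the identity modulo P' and corresponds to projecting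
    -- points onto the zero set of P'. Hence σ f vanishes at every point, and f ≡ σ f = 0.
    set σ : (Poly k 𝕜)[X] →+* (Poly k 𝕜)[X] := eval₂RingHom (MvPolynomial.eval₂Hom
      (C.comp MvPolynomial.C) fun t => if t = .inl ⟨0, hi⟩ then C (MvPolynomial.X t) - D
        else C (MvPolynomial.X t)) X with hσ
    have h₁ : (Ideal.Quotient.mk (Ideal.span {D})).comp σ = Ideal.Quotient.mk (Ideal.span {D}) := by
      have hD0 : Ideal.Quotient.mk (Ideal.span {D}) D = 0 :=
        Ideal.Quotient.eq_zero_iff_mem.2 (Ideal.mem_span_singleton_self D)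
      refine Polynomial.ringHom_ext' (MvPolynomial.ringHom_ext (fun a => ?_) fun t => ?_) ?_
      · simp [hσ]
      · simp only [hσ, RingHom.comp_apply, coe_eval₂RingHom, eval₂_C, MvPolynomial.eval₂Hom_X']
        split_ifs
        · rw [map_sub, hD0, sub_zero]
        · rfl
      · simp [hσ]
    have h₂ : σ f = 0 := by
      refine eq_zero_of_ev fun p y => ?_
      set p' : Tgt k → 𝕜 := fun t => if t = .inl ⟨0, hi⟩ then p t - ev p y D else p t with hp'
      have h₃ : (ev p y).comp σ = ev p' y := by
        refine Polynomial.ringHom_ext' (MvPolynomial.ringHom_ext (fun a => ?_) fun t => ?_) ?_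
        · simp [hσ]
        · simp only [hσ, RingHom.comp_apply, coe_eval₂RingHom, eval₂_C, MvPolynomial.eval₂Hom_X',
            ev_C, MvPolynomial.eval_X, hp']
          split_ifs <;> simp
        · simp [hσ]
      have h₄ : ev p' y D = 0 := by
        have h₅ : ev p' y D - ev p y D = -ev p y D := by
          conv_lhs => rw [hD, ev_derivative_polyU hk, ev_derivative_polyU hk]
          rw [add_sub_add_left_eq_sub, ← Finset.sum_sub_distrib,
            Finset.sum_eq_single (⟨0, hi⟩ : Fin (k - 2))]
          · simp [hp']
          · intro b _ hb
            simp [hp', hb]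
          · simp
        linear_combination h₅
      rw [← RingHom.comp_apply, h₃]
      exact h p' y h₄
    have h₃ := RingHom.congr_fun h₁ f
    rw [RingHom.comp_apply, h₂, map_zero, eq_comm, Ideal.Quotient.eq_zero_iff_mem,
      Ideal.mem_span_singleton] at h₃
    exact h₃

end Evaluation

/-! ### The differential of the cross cap and the passage from smooth to polynomial lifts. -/

section Lift

variable {k : ℕ} {𝕜 : Type*} [RCLike 𝕜]

lemma differentiableAt_crossCap (x : Src k → 𝕜) (t : Tgt k) :
    DifferentiableAt 𝕜 (fun x => crossCap k 𝕜 x t) x := by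
  rcases t with i | i | i
  · simp only [crossCap]
    fun_prop
  · simp only [crossCap]
    fun_prop
  · fin_cases i
    · simp only [crossCap]
      fun_prop
    · simp only [crossCap]
      fun_prop

lemma fderiv_crossCap_apply (x v : Src k → 𝕜) (t : Tgt k) :
    fderiv 𝕜 (crossCap k 𝕜) x v t = fderiv 𝕜 (fun x => crossCap k 𝕜 x t) x v := by
  have h := fderiv_pi (𝕜 := 𝕜) (φ := fun t x => crossCap k 𝕜 x t) (x := x)
    (differentiableAt_crossCap x)
  change fderiv 𝕜 (fun x t => crossCap k 𝕜 x t) x v t = _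
  rw [h]
  rfl

lemma fderiv_crossCap_inl (x v : Src k → 𝕜) (i : Fin (k - 2)) :
    fderiv 𝕜 (crossCap k 𝕜) x v (.inl i) = v (.inl i) := by
  rw [fderiv_crossCap_apply]
  exact congrFun (congrArg _ (hasFDerivAt_apply (𝕜 := 𝕜) (Sum.inl i : Src k) x).fderiv) v

lemma fderiv_crossCap_inr_inl (x v : Src k → 𝕜) (i : Fin (k - 1)) :
    fderiv 𝕜 (crossCap k 𝕜) x v (.inr (.inl i)) = v (.inr (.inl i)) := by
  rw [fderiv_crossCap_apply]
  exact congrFun (congrArg _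
    (hasFDerivAt_apply (𝕜 := 𝕜) (Sum.inr (Sum.inl i) : Src k) x).fderiv) v

lemma fderiv_crossCap_W₁ (x v : Src k → 𝕜) :
    fderiv 𝕜 (crossCap k 𝕜) x v (.inr (.inr 0)) =
      (k * x (.inr (.inr ())) ^ (k - 1) + ∑ i : Fin (k - 2),
        x (.inl i) * (((i : ℕ) + 1) * x (.inr (.inr ())) ^ (i : ℕ))) * v (.inr (.inr ())) +
      ∑ i : Fin (k - 2), v (.inl i) * x (.inr (.inr ())) ^ ((i : ℕ) + 1) := by
  rw [fderiv_crossCap_apply]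
  have hy := hasFDerivAt_apply (𝕜 := 𝕜) (Sum.inr (Sum.inr ()) : Src k) x
  have h := (hy.pow k).add (HasFDerivAt.fun_sum (u := Finset.univ) fun (i : Fin (k - 2)) _ =>
    (hasFDerivAt_apply (𝕜 := 𝕜) (Sum.inl i : Src k) x).mul (hy.pow ((i : ℕ) + 1)))
  refine (congrFun (congrArg _ h.fderiv) v).trans ?_
  simp [Finset.sum_add_distrib, add_mul, Finset.sum_mul]
  rw [add_assoc]
  congr 2 <;> exact Finset.sum_congr rfl fun i _ => by ring

lemma fderiv_crossCap_W₂ (x v : Src k → 𝕜) :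
    fderiv 𝕜 (crossCap k 𝕜) x v (.inr (.inr 1)) =
      (∑ i : Fin (k - 1), x (.inr (.inl i)) * (((i : ℕ) + 1) * x (.inr (.inr ())) ^ (i : ℕ))) *
        v (.inr (.inr ())) +
      ∑ i : Fin (k - 1), v (.inr (.inl i)) * x (.inr (.inr ())) ^ ((i : ℕ) + 1) := by
  rw [fderiv_crossCap_apply]
  have hy := hasFDerivAt_apply (𝕜 := 𝕜) (Sum.inr (Sum.inr ()) : Src k) x
  have h := HasFDerivAt.fun_sum (u := Finset.univ) fun (i : Fin (k - 1)) _ =>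
    (hasFDerivAt_apply (𝕜 := 𝕜) (Sum.inr (Sum.inl i) : Src k) x).mul (hy.pow ((i : ℕ) + 1))
  refine (congrFun (congrArg _ h.fderiv) v).trans ?_
  simp [Finset.sum_add_distrib, add_mul, Finset.sum_mul]
  congr 1 <;> exact Finset.sum_congr rfl fun i _ => by ring

/-- A polynomial vector field that is liftable over the cross cap mapping has a polynomial lift. -/
theorem mem_algLift_of_liftable (hk : 2 ≤ k) {ξ : PolyField k 𝕜}
    (hξ : Liftable (crossCap k 𝕜) ξ.toFun) : ξ ∈ algLift k 𝕜 := by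
  obtain ⟨N, η, hN, h0, -, hη⟩ := hξ
  have hα : ∀ p y, src p y ∈ N → ev p y (pullPoly k 𝕜 (alpha k 𝕜 ξ)) =
      ev p y (derivative (polyU k 𝕜)) * η (src p y) (.inr (.inr ())) := by
    intro p y hx
    have h := fun t => congrFun (hη _ hx) t
    have h₁ := h (.inr (.inr 0))
    rw [fderiv_crossCap_W₁] at h₁
    rw [pullPoly_alpha, ev_derivative_polyU hk, map_sub, map_sum, ev_pull hk]
    simp only [map_mul, map_pow, ev_X, ev_pull hk]
    have h₂ : ∀ i, MvPolynomial.eval (crossCap k 𝕜 (src p y)) (ξ (.inl i)) = η (src p y) (.inl i) :=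
      fun i => ((fderiv_crossCap_inl _ _ i).symm.trans (h (.inl i))).symm
    simp only [h₂]
    exact sub_eq_iff_eq_add.2 h₁.symm
  have hβ : ∀ p y, src p y ∈ N → ev p y (pullPoly k 𝕜 (beta k 𝕜 ξ)) =
      ev p y (derivative (polyV k 𝕜)) * η (src p y) (.inr (.inr ())) := by
    intro p y hx
    have h := fun t => congrFun (hη _ hx) t
    have h₁ := h (.inr (.inr 1))
    rw [fderiv_crossCap_W₂] at h₁
    rw [pullPoly_beta, ev_derivative_polyV hk, map_sub, map_sum, ev_pull hk]
    simp only [map_mul, map_pow, ev_X, ev_pull hk]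
    have h₂ : ∀ i, MvPolynomial.eval (crossCap k 𝕜 (src p y)) (ξ (.inr (.inl i))) =
        η (src p y) (.inr (.inl i)) :=
      fun i => ((fderiv_crossCap_inr_inl _ _ i).symm.trans (h (.inr (.inl i)))).symm
    simp only [h₂]
    exact sub_eq_iff_eq_add.2 h₁.symm
  obtain ⟨h, hh⟩ : derivative (polyU k 𝕜) ∣ pullPoly k 𝕜 (alpha k 𝕜 ξ) := by
    refine derivative_polyU_dvd hk fun p y hpy => ev_eq_zero_of_dilate hN h0 p y _ fun s hs => ?_
    rw [hα _ _ hs, ev_dilate_derivative_polyU hk, hpy, mul_zero, zero_mul]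
  -- The second equation follows on multiplying by P' ≠ 0: eliminating the y-component of η gives P'
  -- · (pullback of `beta`) = Q' · (pullback of `alpha`) near 0, hence identically by dilation.
  refine ⟨h, hh, mul_left_cancel₀ (derivative_polyU_ne_zero hk) (sub_eq_zero.1 ?_)⟩
  rw [mul_left_comm, ← hh]
  refine eq_zero_of_ev fun p y => ev_eq_zero_of_dilate hN h0 p y _ fun s hs => ?_
  rw [map_sub, map_mul, map_mul, hα _ _ hs, hβ _ _ hs]
  ring

end Lift

end CrossCap

end


theorem mainTheorem2 {𝕜 : Type*} [RCLike 𝕜] (k : ℕ) (hk : 2 ≤ k)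
    (ξ : CrossCap.PolyField k 𝕜)
    (hξ : CrossCap.Liftable (CrossCap.crossCap k 𝕜) ξ.toFun) :
    ∃ (gₑ : CrossCap.Poly k 𝕜) (g : Fin 3 → ℕ → CrossCap.Poly k 𝕜),
      ξ = gₑ • CrossCap.eulerField k 𝕜 +
        ∑ i : Fin 3, ∑ j ∈ Finset.Icc 1 (k - 1), g i j • CrossCap.family k 𝕜 i j :=
  CrossCap.exists_eq_of_mem_genSpan
    (CrossCap.algLift_le_genSpan hk (CrossCap.mem_algLift_of_liftable hk hξ))
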